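/- **Theorem.** Let $n$ be a positive integer with $n\notin\{1,2,3,4,5,6,8,10,12\}$, let $\Psi_n(x)$ be the minimal polynomial over $\mathbb Q$ of $2\cos(2\pi/n)$, and let $\Psi_n(x,y)=y^{\deg \Psi_n}\Psi_n(x/y)$ be its homogenization. For a binary form $F$ with rational coefficients and a rational matrix $M=\begin{pmatrix}s&u\\t&v\end{pmatrix}$ put $F_M(x,y)=F(sx+uy,\,tx+vy)$. Let $\operatorname{Aut}F$ be the set of all rational $2\times2$ matrices $M$ with $F_M=F$, and let $\operatorname{Aut}|F|$ be the set of all rational $2\times 2$ matrices $M$ with $F_M=F$ or $F_M=-F$. Write $\langle\cdots\rangle$ for the subgroup of $\mathrm{GL}_2(\mathbb Q)$ generated by the listed matrices, $I$ for the $2\times2$ identity matrix, and $$\mathbf C_1=\langle I\rangle,\quad \mathbf C_2=\langle -I\rangle,\quad \mathbf C_3=\left\langle\begin{pmatrix}0&1\\-1&-1\end{pmatrix}\right\rangle,\quad \mathbf C_4=\left\langle\begin{pmatrix}0&1\\-1&0\end{pmatrix}\right\rangle,\quad \mathbf C_6=\left\langle\begin{pmatrix}0&-1\\1&1\end{pmatrix}\right\rangle,$$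 $$\mathbf D_2=\left\langle\begin{pmatrix}0&1\\1&0\end{pmatrix},-I\right\rangle,\quad \mathbf D_4=\left\langle\begin{pmatrix}0&1\\1&0\end{pmatrix},\begin{pmatrix}0&1\\-1&0\end{pmatrix}\right\rangle.$$ Write $G\cong H$ if $G$ and $H$ are conjugate in $\mathrm{GL}_2(\mathbb Q)$ (so in particular isomorphic). Let $d=\varphi(n)/2$. Then $\deg\Psi_n=d\ge 3$, and the following hold. 1. If $d\ge5$ is odd, then $\operatorname{Aut}\Psi_n=\{I\}\cong\mathbf C_1$ and $\operatorname{Aut}|\Psi_n|=\{\pm I\}\cong\mathbf C_2$. 2. If $d\ge6$ is even and $4\nmid n$, then $\operatorname{Aut}\Psi_n=\operatorname{Aut}|\Psi_n|=\{\pm I\}\cong\mathbf C_2$. 3. If $4\mid n$ and $n\ne24$, then $$\operatorname{Aut}\Psi_n=\operatorname{Aut}|\Psi_n|=\left\langle\begin{pmatrix}-1&0\\0&1\end{pmatrix},\begin{pmatrix}1&0\\0&-1\end{pmatrix}\right\rangle\cong\mathbf D_2 .$$ 4. For $n\in\{7,9,14,15,18,24,30\}$: - if $n\in\{7,18\}$,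 then $\operatorname{Aut}\Psi_n=\left\langle\begin{pmatrix}-1&-1\\1&0\end{pmatrix}\right\rangle\cong\mathbf C_3$ and $\operatorname{Aut}|\Psi_n|=\left\langle\begin{pmatrix}-1&-1\\1&0\end{pmatrix},-I\right\rangle\cong\mathbf C_6$; - if $n\in\{9,14\}$, then $\operatorname{Aut}\Psi_n=\left\langle\begin{pmatrix}-1&1\\-1&0\end{pmatrix}\right\rangle\cong\mathbf C_3$ and $\operatorname{Aut}|\Psi_n|=\left\langle\begin{pmatrix}-1&1\\-1&0\end{pmatrix},-I\right\rangle\cong\mathbf C_6$; - if $n=15$, then $\operatorname{Aut}\Psi_n=\operatorname{Aut}|\Psi_n|=\left\langle\begin{pmatrix}-1&2\\-1&1\end{pmatrix}\right\rangle\cong\mathbf C_4$; - if $n=24$, then $\operatorname{Aut}\Psi_n=\operatorname{Aut}|\Psi_n|=\left\langle\begin{pmatrix}0&1\\1&0\end{pmatrix},\begin{pmatrix}0&1\\-1&0\end{pmatrix}\right\rangle=\mathbf D_4$; - if $n=30$, then $\operatorname{Aut}\Psi_n=\operatorname{Aut}|\Psi_n|=\left\langle\begin{pmatrix}1&2\\-1&-1\end{pmatrix}\right\rangle\cong\mathbf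 C_4$. -/

import Mathlib

/-- The polynomial `Ψ_n(x)`: the minimal polynomial of `2 cos (2π / n)` over `ℚ`. -/
noncomputable def psiPoly (n : ℕ) : Polynomial ℚ :=
  minpoly ℚ (2 * Real.cos (2 * Real.pi / (n : ℝ)))

/-- The binary form `Ψ_n(x, y) = y ^ d * Ψ_n(x / y)`, where `d` is the degree of `Ψ_n(x)`;
the variable `x` is `X 0` and the variable `y` is `X 1`. -/
noncomputable def psiForm (n : ℕ) : MvPolynomial (Fin 2) ℚ :=
  (psiPoly n).homogenize (psiPoly n).natDegree

/-- For `M = !![s, u; t, v]`, the form `F_M(x, y) = F(s x + u y, t x + v y)`. -/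
noncomputable def formSubst (F : MvPolynomial (Fin 2) ℚ) (M : Matrix (Fin 2) (Fin 2) ℚ) :
    MvPolynomial (Fin 2) ℚ :=
  MvPolynomial.bind₁ (fun i : Fin 2 =>
    MvPolynomial.C (M i 0) * MvPolynomial.X 0 + MvPolynomial.C (M i 1) * MvPolynomial.X 1) F

/-- `Aut F`: all rational `2 × 2` matrices `M` with `F_M = F`. -/
def formAut (F : MvPolynomial (Fin 2) ℚ) : Set (Matrix (Fin 2) (Fin 2) ℚ) :=
  {M | formSubst F M = F}

/-- `Aut |F|`: all rational `2 × 2` matrices `M` with `F_M = F` or `F_M = -F`. -/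
def formAutAbs (F : MvPolynomial (Fin 2) ℚ) : Set (Matrix (Fin 2) (Fin 2) ℚ) :=
  {M | formSubst F M = F ∨ formSubst F M = -F}

/-- The subgroup of `GL₂(ℚ)` generated by a set `S` of (invertible) matrices, as a set of
matrices. -/
def matrixGroup (S : Set (Matrix (Fin 2) (Fin 2) ℚ)) : Set (Matrix (Fin 2) (Fin 2) ℚ) :=
  (fun g : GL (Fin 2) ℚ => (g : Matrix (Fin 2) (Fin 2) ℚ)) ''
    (Subgroup.closure {g : GL (Fin 2) ℚ | (g : Matrix (Fin 2) (Fin 2) ℚ) ∈ S} :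
      Set (GL (Fin 2) ℚ))

/-- `H` and `K` are conjugate in `GL₂(ℚ)`, that is, `H = g K g⁻¹` for some `g` in `GL₂(ℚ)`.
If `H` and `K` are matrix groups, conjugation by `g` is an isomorphism of groups. -/
def GLConjugate (H K : Set (Matrix (Fin 2) (Fin 2) ℚ)) : Prop :=
  ∃ g : GL (Fin 2) ℚ, H = (fun M => (g : Matrix (Fin 2) (Fin 2) ℚ) * M *
    ((g⁻¹ : GL (Fin 2) ℚ) : Matrix (Fin 2) (Fin 2) ℚ)) '' K

/-- The trivial group. -/
def groupC1 : Set (Matrix (Fin 2) (Fin 2) ℚ) := matrixGroup {!![1, 0; 0, 1]}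

/-- The standard cyclic group of order `2`, generated by `-I`. -/
def groupC2 : Set (Matrix (Fin 2) (Fin 2) ℚ) := matrixGroup {!![-1, 0; 0, -1]}

/-- The standard cyclic group of order `3`. -/
def groupC3 : Set (Matrix (Fin 2) (Fin 2) ℚ) := matrixGroup {!![0, 1; -1, -1]}

/-- The standard cyclic group of order `4`. -/
def groupC4 : Set (Matrix (Fin 2) (Fin 2) ℚ) := matrixGroup {!![0, 1; -1, 0]}

/-- The standard cyclic group of order `6`. -/
def groupC6 : Set (Matrix (Fin 2) (Fin 2) ℚ) := matrixGroup {!![0, -1; 1, 1]}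

/-- The standard dihedral group of order `4`. -/
def groupD2 : Set (Matrix (Fin 2) (Fin 2) ℚ) :=
  matrixGroup {!![0, 1; 1, 0], !![-1, 0; 0, -1]}

/-- The standard dihedral group of order `8`. -/
def groupD4 : Set (Matrix (Fin 2) (Fin 2) ℚ) :=
  matrixGroup {!![0, 1; 1, 0], !![0, 1; -1, 0]}

/-!
Let `ζ` be a primitive `n`-th root of unity and `α = ζ + ζ⁻¹`, an element of the abelian extension
`ℚ(ζ)` of `ℚ`. A matrix in `Aut |Ψ_n|` is a Möbius map sending `α` to a conjugate `σ α`. Every `τ`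
in the Galois group commutes with `σ`, so the same Möbius map sends `τ α` to `τ (σ α)`, and
comparing the two relations constrains the matrix.

* If `n` is odd, some `τ` has `τ α = α² - 2`. For degree at least `5` the resulting polynomial
  relation between `1, α, …, α⁴` forces the matrix to be scalar.
* If `4 ∣ n`, some `τ` has `τ α = -α`, and the matrix is diagonal or antidiagonal. In the
  antidiagonal case `c = α * σ α` is rational. A second automorphism, mapping `ζ` to `± i ζ` or
  `± i ζ²`, then makes `α` a root of a rational quartic, so `n` is `16`, `20` or `24`; the first two
  would give `c² = 2` and `c² = 5`.
* If `n ≡ 2` modulo `4`, then `-ζ` is a primitive root of unity of order `n / 2`, which replaces `α`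
  by `-α`.

In degrees `3` and `4` the conjugates of `α` are explicit polynomials or fractions in `α`. As the
degree is at least `3`, a matrix is determined up to sign by the image of `α`.
-/

theorem two_pow_le_two_mul_totient_sq (k : ℕ) : 2 ^ k ≤ 2 * (2 ^ k).totient ^ 2 := by
  cases k with
  | zero => simp
  | succ j =>
    rw [Nat.totient_prime_pow_succ Nat.prime_two, Nat.add_one_sub_one, mul_one, pow_succ']
    exact Nat.mul_le_mul_left 2 (Nat.le_self_pow two_ne_zero _)

theorem le_totient_sq_of_odd {n : ℕ} (hn : Odd n) : n ≤ n.totient ^ 2 := by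
  induction n using Nat.recOnPosPrimePosCoprime with
  | zero => simp
  | one => simp
  | prime_pow p k hp hk =>
    obtain ⟨j, rfl⟩ := Nat.exists_eq_add_one.2 hk
    have hp2 : p ≠ 2 := by
      rintro rfl
      exact absurd hn (by simp [Nat.even_pow])
    have hp_le : p ≤ (p - 1) ^ 2 := by
      obtain ⟨q, rfl⟩ := Nat.exists_eq_add_of_le (hp.two_le.lt_of_ne' hp2)
      rw [show 2 + 1 + q - 1 = q + 2 by omega]
      nlinarith
    rw [Nat.totient_prime_pow_succ hp, mul_pow, pow_succ]
    exact Nat.mul_le_mul (Nat.le_self_pow two_ne_zero _) hp_le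
  | coprime a b _ _ hab iha ihb =>
    rw [Nat.odd_mul] at hn
    rw [Nat.totient_mul hab, mul_pow]
    exact Nat.mul_le_mul (iha hn.1) (ihb hn.2)

theorem le_two_mul_totient_sq (n : ℕ) : n ≤ 2 * n.totient ^ 2 := by
  rcases eq_or_ne n 0 with rfl | hn
  · simp
  obtain ⟨k, m, hm, rfl⟩ := Nat.exists_eq_two_pow_mul_odd hn
  rw [Nat.totient_mul (hm.coprime_two_left.pow_left k), mul_pow, ← mul_assoc]
  exact Nat.mul_le_mul (two_pow_le_two_mul_totient_sq k) (le_totient_sq_of_odd hm)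

theorem three_le_totient_div_two {n : ℕ} (hn : 0 < n)
    (hn' : n ∉ ({1, 2, 3, 4, 5, 6, 8, 10, 12} : Set ℕ)) : 3 ≤ n.totient / 2 := by
  by_contra! hlt
  have hn50 : n ≤ 50 := (le_two_mul_totient_sq n).trans (by
    have : n.totient ≤ 5 := by omega
    nlinarith)
  have hsmall : ∀ m < 51, m.totient / 2 < 3 →
      m = 0 ∨ m ∈ ({1, 2, 3, 4, 5, 6, 8, 10, 12} : Finset ℕ) := by
    decide
  simpa [hn.ne', ← Finset.mem_coe, hn'] using hsmall n (by omega) hlt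

theorem eq_of_four_dvd_of_totient_div_two_eq_four {n : ℕ} (h4 : 4 ∣ n) (h : n.totient / 2 = 4) :
    n = 16 ∨ n = 20 ∨ n = 24 := by
  obtain ⟨m, rfl⟩ := h4
  have hm : 4 * m ≤ 162 := (le_two_mul_totient_sq _).trans (by
    have : (4 * m).totient ≤ 9 := by omega
    nlinarith)
  have hsmall : ∀ m < 41, (4 * m).totient / 2 = 4 → 4 * m = 16 ∨ 4 * m = 20 ∨ 4 * m = 24 := by
    decide +kernel
  exact hsmall m (by omega) h

theorem even_totient_div_two_of_four_dvd {n : ℕ} (h4 : 4 ∣ n) (hn : 4 < n) :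
    Even (n.totient / 2) := by
  obtain ⟨m, rfl⟩ := h4
  rw [show 4 * m = 2 * (2 * m) by ring, Nat.totient_two_mul_of_even (even_two_mul m),
    Nat.mul_div_cancel_left _ two_pos]
  exact Nat.totient_even (by omega)

theorem coeffs_eq_zero_of_sum_pow_eq_zero {K : Type*} [Field K] [CharZero K] {α : K} {k : ℕ}
    (hk : k ≤ (minpoly ℚ α).natDegree) {a : Fin k → ℚ}
    (h : ∑ i, (a i : K) * α ^ (i : ℕ) = 0) : a = 0 := by
  have hindep := (linearIndependent_pow (K := ℚ) α).comp _ (Fin.castLE_injective hk)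
  exact funext <| Fintype.linearIndependent_iff.1 hindep a (by simpa [Rat.smul_def] using h)

open scoped Matrix

section Substitution

variable {F : MvPolynomial (Fin 2) ℚ} {d : ℕ}

theorem aeval_formSubst {A : Type*} [CommRing A] [Algebra ℚ A] (F : MvPolynomial (Fin 2) ℚ)
    (M : Matrix (Fin 2) (Fin 2) ℚ) (x : Fin 2 → A) :
    MvPolynomial.aeval x (formSubst F M) =
      MvPolynomial.aeval (M.map (algebraMap ℚ A) *ᵥ x) F := by
  rw [formSubst, MvPolynomial.aeval_bind₁]
  congr 2
  funext i
  simp [Matrix.mulVec, dotProduct]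

theorem eval_formSubst (F : MvPolynomial (Fin 2) ℚ) (M : Matrix (Fin 2) (Fin 2) ℚ)
    (x : Fin 2 → ℚ) : MvPolynomial.eval x (formSubst F M) = MvPolynomial.eval (M *ᵥ x) F :=
  aeval_formSubst F M x

theorem formSubst_one (F : MvPolynomial (Fin 2) ℚ) : formSubst F 1 = F :=
  MvPolynomial.funext fun x => by rw [eval_formSubst, Matrix.one_mulVec]

theorem formSubst_mul (F : MvPolynomial (Fin 2) ℚ) (M N : Matrix (Fin 2) (Fin 2) ℚ) :
    formSubst F (M * N) = formSubst (formSubst F M) N :=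
  MvPolynomial.funext fun x => by simp only [eval_formSubst, Matrix.mulVec_mulVec]

theorem formSubst_neg_left (F : MvPolynomial (Fin 2) ℚ) (M : Matrix (Fin 2) (Fin 2) ℚ) :
    formSubst (-F) M = -formSubst F M :=
  map_neg _ F

theorem isHomogeneous_formSubst (hF : F.IsHomogeneous d) (M : Matrix (Fin 2) (Fin 2) ℚ) :
    (formSubst F M).IsHomogeneous d := by
  rw [← one_mul d]
  exact hF.aeval _ fun i => ((MvPolynomial.isHomogeneous_X _ _).C_mul _).add
    ((MvPolynomial.isHomogeneous_X _ _).C_mul _)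

theorem eval_smul_of_isHomogeneous {R σ : Type*} [CommSemiring R] {G : MvPolynomial σ R}
    (hG : G.IsHomogeneous d) (c : R) (x : σ → R) :
    MvPolynomial.eval (c • x) G = c ^ d * MvPolynomial.eval x G := by
  simp only [MvPolynomial.eval_eq, Finset.mul_sum, Pi.smul_apply, smul_eq_mul, mul_pow,
    Finset.prod_mul_distrib, Finset.prod_pow_eq_pow_sum]
  refine Finset.sum_congr rfl fun m hm => ?_
  rw [hG.degree_eq_sum_deg_support hm, mul_left_comm]

theorem formSubst_smul (hF : F.IsHomogeneous d) (c : ℚ) (M : Matrix (Fin 2) (Fin 2) ℚ) :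
    formSubst F (c • M) = c ^ d • formSubst F M :=
  MvPolynomial.funext fun x => by
    rw [eval_formSubst, MvPolynomial.smul_eval, eval_formSubst, Matrix.smul_mulVec,
      eval_smul_of_isHomogeneous hF]

theorem formSubst_neg_of_even (hF : F.IsHomogeneous d) (hd : Even d)
    (M : Matrix (Fin 2) (Fin 2) ℚ) : formSubst F (-M) = formSubst F M := by
  simpa [hd.neg_one_pow] using formSubst_smul hF (-1) M

theorem formSubst_neg_of_odd (hF : F.IsHomogeneous d) (hd : Odd d)
    (M : Matrix (Fin 2) (Fin 2) ℚ) : formSubst F (-M) = -formSubst F M := by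
  simpa [hd.neg_one_pow] using formSubst_smul hF (-1) M

theorem formAut_subset_formAutAbs (F : MvPolynomial (Fin 2) ℚ) : formAut F ⊆ formAutAbs F :=
  fun _ => Or.inl

theorem formAut_neg (F : MvPolynomial (Fin 2) ℚ) : formAut (-F) = formAut F :=
  Set.ext fun M => by
    change formSubst (-F) M = -F ↔ formSubst F M = F
    rw [formSubst_neg_left, neg_inj]

theorem formAutAbs_neg (F : MvPolynomial (Fin 2) ℚ) : formAutAbs (-F) = formAutAbs F :=
  Set.ext fun M => by
    change formSubst (-F) M = -F ∨ formSubst (-F) M = - -F ↔ formSubst F M = F ∨ formSubst F M = -F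
    rw [formSubst_neg_left, neg_inj, neg_inj]

theorem abs_eval_mulVec {M : Matrix (Fin 2) (Fin 2) ℚ} (hM : M ∈ formAutAbs F)
    (x : Fin 2 → ℚ) : |MvPolynomial.eval (M *ᵥ x) F| = |MvPolynomial.eval x F| := by
  rw [← eval_formSubst]
  exact hM.elim (by rw [·]) (by rw [·, map_neg, abs_neg])

/-- A form is anisotropic over `ℚ` if it vanishes exactly at the origin of `ℚ²`. -/
def IsAnisotropicForm (F : MvPolynomial (Fin 2) ℚ) : Prop :=
  ∀ x : Fin 2 → ℚ, MvPolynomial.eval x F = 0 ↔ x = 0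

namespace IsAnisotropicForm

theorem det_ne_zero (hF : IsAnisotropicForm F) {M : Matrix (Fin 2) (Fin 2) ℚ}
    (hM : M ∈ formAutAbs F) : M.det ≠ 0 := by
  intro hdet
  obtain ⟨x, hx, hMx⟩ := Matrix.exists_mulVec_eq_zero_iff.2 hdet
  have hFx := abs_eval_mulVec hM x
  rw [hMx, (hF 0).2 rfl, abs_zero, eq_comm, abs_eq_zero] at hFx
  exact hx ((hF x).1 hFx)

theorem eq_one_or_eq_neg_one_of_abs_eval_smul (hF : IsAnisotropicForm F)
    (hFd : F.IsHomogeneous d) (hd : d ≠ 0) {c : ℚ} {x : Fin 2 → ℚ} (hx : x ≠ 0)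
    (h : |MvPolynomial.eval (c • x) F| = |MvPolynomial.eval x F|) : c = 1 ∨ c = -1 := by
  have hFx : |MvPolynomial.eval x F| ≠ 0 := abs_ne_zero.2 (mt (hF x).1 hx)
  rw [eval_smul_of_isHomogeneous hFd, abs_mul, mul_eq_right₀ hFx, abs_pow] at h
  exact eq_or_eq_neg_of_abs_eq ((pow_eq_one_iff_of_nonneg (abs_nonneg c) hd).1 h)

theorem eigenvalue_eq_one_or_eq_neg_one (hF : IsAnisotropicForm F)
    (hFd : F.IsHomogeneous d) (hd : d ≠ 0) {M : Matrix (Fin 2) (Fin 2) ℚ} (hM : M ∈ formAutAbs F)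
    {c : ℚ} {x : Fin 2 → ℚ} (hx : x ≠ 0) (hMx : M *ᵥ x = c • x) : c = 1 ∨ c = -1 :=
  hF.eq_one_or_eq_neg_one_of_abs_eval_smul hFd hd hx (hMx ▸ abs_eval_mulVec hM x)

theorem eq_one_or_eq_neg_one_of_smul_mem (hF : IsAnisotropicForm F)
    (hFd : F.IsHomogeneous d) (hd : d ≠ 0) {M : Matrix (Fin 2) (Fin 2) ℚ} (hM : M ∈ formAutAbs F)
    {c : ℚ} (hcM : c • M ∈ formAutAbs F) : c = 1 ∨ c = -1 := by
  have he : (![1, 0] : Fin 2 → ℚ) ≠ 0 := by simp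
  refine hF.eq_one_or_eq_neg_one_of_abs_eval_smul hFd hd (x := M *ᵥ ![1, 0])
    (fun h => he (Matrix.eq_zero_of_mulVec_eq_zero (hF.det_ne_zero hM) h)) ?_
  rw [← Matrix.smul_mulVec, abs_eval_mulVec hcM, abs_eval_mulVec hM]

end IsAnisotropicForm

end Substitution

section Groups

variable {F : MvPolynomial (Fin 2) ℚ} {S T : Set (Matrix (Fin 2) (Fin 2) ℚ)}
  {A B : Matrix (Fin 2) (Fin 2) ℚ}

/-- `Aut F` inside `GL₂(ℚ)`, where singular matrices are left out. -/
def formAutSubgroup (F : MvPolynomial (Fin 2) ℚ) : Subgroup (GL (Fin 2) ℚ) where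
  carrier := {g | formSubst F g = F}
  one_mem' := formSubst_one F
  mul_mem' {g h} (hg : formSubst F g = F) (hh : formSubst F h = F) := by
    change formSubst F (g * h) = F
    rw [formSubst_mul, hg, hh]
  inv_mem' {g} (hg : formSubst F g = F) := by
    change formSubst F (↑g⁻¹) = F
    nth_rewrite 1 [← hg]
    rw [← formSubst_mul, Units.mul_inv, formSubst_one]

/-- `Aut |F|` inside `GL₂(ℚ)`, where singular matrices are left out. -/
def formAutAbsSubgroup (F : MvPolynomial (Fin 2) ℚ) : Subgroup (GL (Fin 2) ℚ) where
  carrier := {g | formSubst F g = F ∨ formSubst F g = -F}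
  one_mem' := Or.inl (formSubst_one F)
  mul_mem' {g h} (hg : formSubst F g = F ∨ formSubst F g = -F)
      (hh : formSubst F h = F ∨ formSubst F h = -F) := by
    change formSubst F (g * h) = F ∨ formSubst F (g * h) = -F
    rcases hg with hg | hg <;> rcases hh with hh | hh <;>
      simp [formSubst_mul, formSubst_neg_left, hg, hh]
  inv_mem' {g} (hg : formSubst F g = F ∨ formSubst F g = -F) := by
    change formSubst F (↑g⁻¹) = F ∨ formSubst F (↑g⁻¹) = -F
    have hinv : formSubst (formSubst F g) ↑g⁻¹ = F := by
      rw [← formSubst_mul, Units.mul_inv, formSubst_one]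
    rcases hg with hg | hg
    · exact .inl (by rwa [hg] at hinv)
    · rw [hg, formSubst_neg_left] at hinv
      exact .inr (neg_eq_iff_eq_neg.1 hinv)

theorem matrixGroup_subset_formAut (hS : S ⊆ formAut F) : matrixGroup S ⊆ formAut F :=
  Set.image_subset_iff.2 <|
    (Subgroup.closure_le (formAutSubgroup F)).2 fun _ hg => hS (Set.mem_ofPred.1 hg)

theorem matrixGroup_subset_formAutAbs (hS : S ⊆ formAutAbs F) : matrixGroup S ⊆ formAutAbs F :=
  Set.image_subset_iff.2 <|
    (Subgroup.closure_le (formAutAbsSubgroup F)).2 fun _ hg => hS (Set.mem_ofPred.1 hg)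

theorem isUnit_of_det_ne_zero (hA : A.det ≠ 0) : IsUnit A :=
  (Matrix.isUnit_iff_isUnit_det A).2 hA.isUnit

theorem mem_matrixGroup_of_isUnit (hA : A ∈ S) (hA' : IsUnit A) : A ∈ matrixGroup S := by
  obtain ⟨g, rfl⟩ := hA'
  exact ⟨g, Subgroup.subset_closure hA, rfl⟩

theorem one_mem_matrixGroup : 1 ∈ matrixGroup S :=
  ⟨1, one_mem _, rfl⟩

theorem mul_mem_matrixGroup (hA : A ∈ matrixGroup S) (hB : B ∈ matrixGroup S) :
    A * B ∈ matrixGroup S := by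
  obtain ⟨g, hg, rfl⟩ := hA
  obtain ⟨h, hh, rfl⟩ := hB
  exact ⟨g * h, mul_mem hg hh, rfl⟩

theorem matrixGroup_subset_matrixGroup (hST : S ⊆ matrixGroup T) :
    matrixGroup S ⊆ matrixGroup T := by
  refine Set.image_mono ((Subgroup.closure_le _).2 fun g hg => ?_)
  obtain ⟨h, hh, hgh⟩ := hST hg
  rwa [← Units.ext hgh]

theorem matrixGroup_eq_of_subset (hST : S ⊆ matrixGroup T) (hTS : T ⊆ matrixGroup S) :
    matrixGroup S = matrixGroup T :=
  (matrixGroup_subset_matrixGroup hST).antisymm (matrixGroup_subset_matrixGroup hTS)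

end Groups

section Conjugation

/-- Conjugation `M ↦ g M g⁻¹` of matrices, as it appears in `GLConjugate`. -/
def matrixConj (g : GL (Fin 2) ℚ) (M : Matrix (Fin 2) (Fin 2) ℚ) : Matrix (Fin 2) (Fin 2) ℚ :=
  g * M * (g⁻¹ : GL (Fin 2) ℚ)

theorem matrixConj_mul (g h : GL (Fin 2) ℚ) (M : Matrix (Fin 2) (Fin 2) ℚ) :
    matrixConj (g * h) M = matrixConj g (matrixConj h M) := by
  simp only [matrixConj, mul_inv_rev, Units.val_mul, mul_assoc]

theorem matrixConj_one (M : Matrix (Fin 2) (Fin 2) ℚ) : matrixConj 1 M = M := by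
  simp [matrixConj]

theorem image_matrixConj (g : GL (Fin 2) ℚ) (H : Set (Matrix (Fin 2) (Fin 2) ℚ)) :
    matrixConj g '' H = matrixConj g⁻¹ ⁻¹' H :=
  congrFun (Set.image_eq_preimage_of_inverse
    (fun M => by rw [← matrixConj_mul, inv_mul_cancel, matrixConj_one])
    (fun M => by rw [← matrixConj_mul, mul_inv_cancel, matrixConj_one])) H

theorem image_matrixConj_matrixGroup_subset (g : GL (Fin 2) ℚ)
    (S : Set (Matrix (Fin 2) (Fin 2) ℚ)) :
    matrixConj g '' matrixGroup S ⊆ matrixGroup (matrixConj g '' S) := by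
  have hle : Subgroup.closure {h : GL (Fin 2) ℚ | (h : Matrix (Fin 2) (Fin 2) ℚ) ∈ S} ≤
      (Subgroup.closure {h : GL (Fin 2) ℚ | (h : Matrix (Fin 2) (Fin 2) ℚ) ∈
        matrixConj g '' S}).comap (MulAut.conj g).toMonoidHom :=
    (Subgroup.closure_le _).2 fun k hk => Subgroup.subset_closure ⟨k, hk, rfl⟩
  rintro _ ⟨_, ⟨h, hh, rfl⟩, rfl⟩
  exact ⟨MulAut.conj g h, hle hh, rfl⟩

theorem image_matrixConj_matrixGroup (g : GL (Fin 2) ℚ) (S : Set (Matrix (Fin 2) (Fin 2) ℚ)) :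
    matrixConj g '' matrixGroup S = matrixGroup (matrixConj g '' S) := by
  refine (image_matrixConj_matrixGroup_subset g S).antisymm ?_
  rw [image_matrixConj g (matrixGroup S), ← Set.image_subset_iff]
  refine (image_matrixConj_matrixGroup_subset g⁻¹ _).trans_eq ?_
  simp only [Set.image_image, ← matrixConj_mul, inv_mul_cancel, matrixConj_one, Set.image_id']

theorem GLConjugate.refl (H : Set (Matrix (Fin 2) (Fin 2) ℚ)) : GLConjugate H H :=
  ⟨1, by simp⟩

theorem GLConjugate.matrixGroup_image (g : GL (Fin 2) ℚ) (S : Set (Matrix (Fin 2) (Fin 2) ℚ)) :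
    GLConjugate (matrixGroup (matrixConj g '' S)) (matrixGroup S) :=
  ⟨g, (image_matrixConj_matrixGroup g S).symm⟩

theorem formSubst_formSubst_eq_iff {F G : MvPolynomial (Fin 2) ℚ} {g : GL (Fin 2) ℚ}
    {M : Matrix (Fin 2) (Fin 2) ℚ} :
    formSubst (formSubst F g) M = formSubst G g ↔ formSubst F (matrixConj g M) = G := by
  rw [matrixConj, formSubst_mul, formSubst_mul]
  constructor <;> intro h
  · rw [h, ← formSubst_mul, Units.mul_inv, formSubst_one]
  · rw [← h, ← formSubst_mul _ _ g, Units.inv_mul, formSubst_one]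

theorem formAut_formSubst (F : MvPolynomial (Fin 2) ℚ) (g : GL (Fin 2) ℚ) :
    formAut (formSubst F g) = matrixConj g⁻¹ '' formAut F := by
  rw [image_matrixConj, inv_inv]
  exact Set.ext fun M => formSubst_formSubst_eq_iff

theorem formAutAbs_formSubst (F : MvPolynomial (Fin 2) ℚ) (g : GL (Fin 2) ℚ) :
    formAutAbs (formSubst F g) = matrixConj g⁻¹ '' formAutAbs F := by
  rw [image_matrixConj, inv_inv]
  refine Set.ext fun M => or_congr formSubst_formSubst_eq_iff ?_
  rw [← formSubst_neg_left, formSubst_formSubst_eq_iff]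

end Conjugation

section MinpolyForm

variable {K : Type*} [Field K] [CharZero K] {α β : K}

/-- The binary form `y ^ d * p(x / y)`, where `p` is the minimal polynomial of `α` over `ℚ` and `d`
is its degree. -/
noncomputable def minpolyForm (α : K) : MvPolynomial (Fin 2) ℚ :=
  (minpoly ℚ α).homogenize (minpoly ℚ α).natDegree

theorem isHomogeneous_minpolyForm (α : K) :
    (minpolyForm α).IsHomogeneous (minpoly ℚ α).natDegree :=
  Polynomial.isHomogeneous_homogenize _

theorem aeval_homogenize {p : Polynomial ℚ} {n : ℕ} (hn : p.natDegree ≤ n) {x : Fin 2 → K}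
    (hx : x 1 ≠ 0) :
    MvPolynomial.aeval x (p.homogenize n) = Polynomial.aeval (x 0 / x 1) p * x 1 ^ n := by
  rw [MvPolynomial.aeval_def, MvPolynomial.eval₂_eq_eval_map, ← Polynomial.homogenize_map,
    Polynomial.eval_homogenize (Polynomial.natDegree_map_le.trans hn) x hx,
    Polynomial.eval_map_algebraMap]

theorem eval_homogenize_natDegree_of_eq_zero (p : Polynomial ℚ) {x : Fin 2 → ℚ} (hx : x 1 = 0) :
    MvPolynomial.eval x (p.homogenize p.natDegree) = p.leadingCoeff * x 0 ^ p.natDegree := by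
  rw [Polynomial.homogenize, map_sum, Finset.sum_eq_single (p.natDegree, 0)]
  · simp [MvPolynomial.eval_monomial, Finsupp.prod_fintype]
  · rintro ⟨i, j⟩ hij hne
    have hj : j ≠ 0 := by
      rintro rfl
      exact hne (by simpa using hij)
    simp [MvPolynomial.eval_monomial, Finsupp.prod_fintype, hx, hj]
  · simp

theorem isIntegral_of_natDegree_minpoly_ne_zero (h : (minpoly ℚ α).natDegree ≠ 0) :
    IsIntegral ℚ α :=
  minpoly.ne_zero_iff.1 fun h0 => h (by rw [h0, Polynomial.natDegree_zero])

theorem isAnisotropicForm_minpolyForm (hα : 2 ≤ (minpoly ℚ α).natDegree) :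
    IsAnisotropicForm (minpolyForm α) := by
  have hint : IsIntegral ℚ α := isIntegral_of_natDegree_minpoly_ne_zero (by omega)
  refine fun x => ⟨fun hx => ?_, ?_⟩
  · by_cases hx1 : x 1 = 0
    · rw [minpolyForm, eval_homogenize_natDegree_of_eq_zero _ hx1,
        (minpoly.monic hint).leadingCoeff, one_mul] at hx
      funext i
      fin_cases i
      · exact eq_zero_of_pow_eq_zero hx
      · exact hx1
    · rw [minpolyForm, Polynomial.eval_homogenize le_rfl x hx1, mul_eq_zero,
        or_iff_left (pow_ne_zero _ hx1)] at hx
      have hdeg : (minpoly ℚ α).natDegree = 1 := Polynomial.natDegree_eq_of_degree_eq_some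
        (Polynomial.degree_eq_one_of_irreducible_of_root (minpoly.irreducible hint) hx)
      omega
  · rintro rfl
    have h := eval_smul_of_isHomogeneous (isHomogeneous_minpolyForm α) 0 0
    rwa [smul_zero, zero_pow (by omega), zero_mul] at h

theorem natDegree_minpoly_neg (α : K) :
    (minpoly ℚ (-α)).natDegree = (minpoly ℚ α).natDegree := by
  rw [minpoly.neg]
  rcases neg_one_pow_eq_or (Polynomial ℚ) (minpoly ℚ α).natDegree with h | h <;>
    simp [h, Polynomial.natDegree_comp]

/-- The substitution `x ↦ -x` in binary forms. -/
def signFlip : GL (Fin 2) ℚ :=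
  ⟨!![-1, 0; 0, 1], !![-1, 0; 0, 1], by decide +kernel, by decide +kernel⟩

theorem minpolyForm_neg (α : K) :
    minpolyForm (-α) =
      (-1 : ℚ) ^ (minpoly ℚ α).natDegree • formSubst (minpolyForm α) signFlip := by
  rw [minpolyForm, natDegree_minpoly_neg]
  refine Polynomial.homogenize_eq_of_isHomogeneous
    ((MvPolynomial.homogeneousSubmodule _ _ _).smul_mem _
      (isHomogeneous_formSubst (isHomogeneous_minpolyForm α) _)) ?_
  rw [map_smul, aeval_formSubst, minpolyForm, Polynomial.aeval_homogenize_of_eq_one le_rfl _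
    (by simp [signFlip, Matrix.mulVec, dotProduct]), minpoly.neg]
  simp [signFlip, Matrix.mulVec, dotProduct, Polynomial.smul_eq_C_mul, Polynomial.comp,
    Polynomial.aeval_def]

end MinpolyForm

theorem minpoly_add_inv_congr {K L : Type*} [Field K] [CharZero K] [Field L] [CharZero L] {x : K}
    {y : L} (hx : IsIntegral ℚ x) (h : minpoly ℚ x = minpoly ℚ y) :
    minpoly ℚ (x + x⁻¹) = minpoly ℚ (y + y⁻¹) := by
  have : Fact (Irreducible (minpoly ℚ x)) := ⟨minpoly.irreducible hx⟩
  let f : AdjoinRoot (minpoly ℚ x) →ₐ[ℚ] K :=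
    AdjoinRoot.liftAlgHom _ (Algebra.ofId ℚ K) x (minpoly.aeval ℚ x)
  let g : AdjoinRoot (minpoly ℚ x) →ₐ[ℚ] L :=
    AdjoinRoot.liftAlgHom _ (Algebra.ofId ℚ L) y (h ▸ minpoly.aeval ℚ y)
  let z := AdjoinRoot.root (minpoly ℚ x)
  have hf : f z = x := AdjoinRoot.liftAlgHom_root ..
  have hg : g z = y := AdjoinRoot.liftAlgHom_root ..
  calc minpoly ℚ (x + x⁻¹)
      = minpoly ℚ (f (z + z⁻¹)) := by rw [map_add, map_inv₀, hf]
    _ = minpoly ℚ (g (z + z⁻¹)) := by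
      rw [minpoly.algHom_eq f f.injective, minpoly.algHom_eq g g.injective]
    _ = minpoly ℚ (y + y⁻¹) := by rw [map_add, map_inv₀, hg]

theorem psiPoly_eq_minpoly_add_inv {K : Type*} [Field K] [CharZero K] {n : ℕ} [NeZero n] {ζ : K}
    (hζ : IsPrimitiveRoot ζ n) : psiPoly n = minpoly ℚ (ζ + ζ⁻¹) := by
  have hη := Complex.isPrimitiveRoot_exp n (NeZero.ne n)
  set η := Complex.exp (2 * Real.pi * Complex.I / n) with hη_def
  have hcos : η + η⁻¹ = algebraMap ℝ ℂ (2 * Real.cos (2 * Real.pi / n)) := by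
    rw [hη_def, ← Complex.exp_neg, Complex.coe_algebraMap]
    push_cast
    rw [Complex.two_cos]
    ring_nf
  have hmin : minpoly ℚ ζ = minpoly ℚ η := by
    rw [← Polynomial.cyclotomic_eq_minpoly_rat hζ (NeZero.pos n),
      ← Polynomial.cyclotomic_eq_minpoly_rat hη (NeZero.pos n)]
  rw [minpoly_add_inv_congr (hζ.isIntegral (NeZero.pos n)).tower_top hmin, hcos,
    minpoly.algebraMap_eq (algebraMap ℝ ℂ).injective, psiPoly]

theorem psiForm_eq_minpolyForm {K : Type*} [Field K] [CharZero K] {n : ℕ} [NeZero n] {ζ : K}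
    (hζ : IsPrimitiveRoot ζ n) : psiForm n = minpolyForm (ζ + ζ⁻¹) := by
  rw [psiForm, psiPoly_eq_minpoly_add_inv hζ, minpolyForm]

section Moebius

variable {K : Type*} [Field K] [CharZero K] {α β : K} {M N : Matrix (Fin 2) (Fin 2) ℚ}

/-- `β = (s α + u) / (t α + v)` for `M = !![s, u; t, v]`, with the denominator cleared so that no
division by zero can occur. -/
def IsMoebiusImage (M : Matrix (Fin 2) (Fin 2) ℚ) (α β : K) : Prop :=
  (M 1 0 * α + M 1 1) * β = M 0 0 * α + M 0 1

theorem IsMoebiusImage.map {L : Type*} [Field L] [CharZero L] (h : IsMoebiusImage M α β)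
    (f : K →ₐ[ℚ] L) : IsMoebiusImage M (f α) (f β) := by
  simpa [IsMoebiusImage] using congrArg f h

theorem coeffs_eq_zero_of_linear_eq_zero (hα : 2 ≤ (minpoly ℚ α).natDegree) {a b : ℚ}
    (h : (a : K) * α + b = 0) : a = 0 ∧ b = 0 := by
  have hab := coeffs_eq_zero_of_sum_pow_eq_zero (a := ![b, a]) hα
    (by simpa [Fin.sum_univ_two, add_comm] using h)
  exact ⟨congrFun hab 1, congrFun hab 0⟩

theorem coeffs_eq_zero_of_quadratic_eq_zero (hα : 3 ≤ (minpoly ℚ α).natDegree) {a b c : ℚ}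
    (h : (a : K) * α ^ 2 + b * α + c = 0) : a = 0 ∧ b = 0 ∧ c = 0 := by
  have habc := coeffs_eq_zero_of_sum_pow_eq_zero (a := ![c, b, a]) hα
    (by
      simp only [Fin.sum_univ_three, Matrix.cons_val, Fin.coe_ofNat_eq_mod, Nat.reduceMod]
      linear_combination h)
  exact ⟨congrFun habc 2, congrFun habc 1, congrFun habc 0⟩

theorem exists_root_isMoebiusImage (hα : 2 ≤ (minpoly ℚ α).natDegree)
    (hM : M ∈ formAutAbs (minpolyForm α)) :
    ∃ β : K, Polynomial.aeval β (minpoly ℚ α) = 0 ∧ IsMoebiusImage M α β := by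
  have hden : (M 1 0 * α + M 1 1 : K) ≠ 0 := fun h => by
    obtain ⟨ht, hv⟩ := coeffs_eq_zero_of_linear_eq_zero hα h
    exact (isAnisotropicForm_minpolyForm hα).det_ne_zero hM (by simp [Matrix.det_fin_two, ht, hv])
  have hα0 : MvPolynomial.aeval ![α, 1] (minpolyForm α) = 0 := by
    rw [minpolyForm, aeval_homogenize le_rfl (by simp)]
    simp
  have hMα : MvPolynomial.aeval ![M 0 0 * α + M 0 1, M 1 0 * α + M 1 1] (minpolyForm α) = 0 := by
    have hsubst : MvPolynomial.aeval ![α, 1] (formSubst (minpolyForm α) M) = 0 :=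
      hM.elim (by rw [·, hα0]) (by rw [·, map_neg, hα0, neg_zero])
    have hvec : M.map (algebraMap ℚ K) *ᵥ ![α, 1] =
        ![M 0 0 * α + M 0 1, M 1 0 * α + M 1 1] := by
      ext i
      fin_cases i <;> simp [Matrix.mulVec, dotProduct]
    rwa [aeval_formSubst, hvec] at hsubst
  rw [minpolyForm, aeval_homogenize le_rfl (by simpa using hden), mul_eq_zero,
    or_iff_left (pow_ne_zero _ (by simpa using hden))] at hMα
  exact ⟨_, hMα, mul_div_cancel₀ _ hden⟩

theorem IsMoebiusImage.adjugate_mul_eq_smul_one (hα : 3 ≤ (minpoly ℚ α).natDegree)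
    (hM : IsMoebiusImage M α β) (hN : IsMoebiusImage N α β) :
    ∃ k : ℚ, N.adjugate * M = k • 1 := by
  obtain ⟨h2, h1, h0⟩ := coeffs_eq_zero_of_quadratic_eq_zero (α := α) hα
    (a := M 0 0 * N 1 0 - N 0 0 * M 1 0)
    (b := M 0 0 * N 1 1 + M 0 1 * N 1 0 - N 0 0 * M 1 1 - N 0 1 * M 1 0)
    (c := M 0 1 * N 1 1 - N 0 1 * M 1 1) (by
      unfold IsMoebiusImage at hM hN
      push_cast
      linear_combination (M 1 0 * α + M 1 1 : K) * hN - (N 1 0 * α + N 1 1 : K) * hM)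
  refine ⟨N 1 1 * M 0 0 - N 0 1 * M 1 0, ?_⟩
  ext i j
  fin_cases i <;> fin_cases j <;> simp [Matrix.adjugate_fin_two, Matrix.mul_apply] <;>
    linarith

theorem eq_or_eq_neg_of_isMoebiusImage (hα : 3 ≤ (minpoly ℚ α).natDegree)
    (hM : M ∈ formAutAbs (minpolyForm α)) (hN : N ∈ formAutAbs (minpolyForm α))
    (hMβ : IsMoebiusImage M α β) (hNβ : IsMoebiusImage N α β) : M = N ∨ M = -N := by
  have hF : IsAnisotropicForm (minpolyForm α) := isAnisotropicForm_minpolyForm (by omega)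
  obtain ⟨k, hk⟩ := hMβ.adjugate_mul_eq_smul_one hα hNβ
  have hMN : M = (N.det⁻¹ * k) • N := by
    rw [mul_smul, eq_inv_smul_iff₀ (hF.det_ne_zero hN)]
    calc N.det • M = N * (N.adjugate * M) := by
          rw [← mul_assoc, Matrix.mul_adjugate, smul_one_mul]
      _ = k • N := by rw [hk, mul_smul_one]
  rcases hF.eq_one_or_eq_neg_one_of_smul_mem (isHomogeneous_minpolyForm α) (by omega) hN
    (hMN ▸ hM) with hc | hc <;> rw [hc] at hMN
  · exact .inl (by rw [hMN, one_smul])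
  · exact .inr (by rw [hMN, neg_one_smul])

theorem eq_zero_of_mul_eq_zero_of_det_ne_zero {s u t v : ℚ} (hdet : s * v - u * t ≠ 0)
    (h : t * ((s - 2 * t) * (s + t)) = 0) (h' : t * (s * u - 2 * t * v - s * v) = 0) : t = 0 := by
  by_contra ht
  have hu := (mul_eq_zero.1 h').resolve_left ht
  rcases mul_eq_zero.1 ((mul_eq_zero.1 h).resolve_left ht) with hs | hs
  · exact hdet (by linear_combination (u + v) / 2 * hs - hu / 2)
  · exact hdet (by linear_combination (2 * v - u) * hs + hu)

theorem IsMoebiusImage.eq_smul_one_of_sq_sub_two (hα : 5 ≤ (minpoly ℚ α).natDegree)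
    (hM : M.det ≠ 0) (h : IsMoebiusImage M α β)
    (h' : IsMoebiusImage M (α ^ 2 - 2) (β ^ 2 - 2)) : M = M 0 0 • 1 := by
  generalize hs : M 0 0 = s
  generalize hu : M 0 1 = u
  generalize ht : M 1 0 = t
  generalize hv : M 1 1 = v
  rw [Matrix.det_fin_two] at hM
  simp only [IsMoebiusImage, hs, hu, ht, hv] at h h' hM
  -- The numerator of `(s α' + u) / (t α' + v) - (β ^ 2 - 2)`, with `α' = α ^ 2 - 2`.
  have hcoeffs := coeffs_eq_zero_of_sum_pow_eq_zero (α := α) hα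
    (a := ![(v - 2 * t) * (u ^ 2 - 2 * v ^ 2) - (u - 2 * s) * v ^ 2,
      (v - 2 * t) * (2 * s * u - 4 * t * v) - (u - 2 * s) * (2 * t * v),
      t * (u ^ 2 - 2 * v ^ 2) + (v - 2 * t) * (s ^ 2 - 2 * t ^ 2) - s * v ^ 2 -
        (u - 2 * s) * t ^ 2,
      t * (2 * s * u - 4 * t * v) - 2 * s * t * v,
      t * s ^ 2 - 2 * t ^ 3 - s * t ^ 2]) (by
    simp only [Fin.sum_univ_five, Matrix.cons_val, Fin.coe_ofNat_eq_mod, Nat.reduceMod]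
    push_cast
    linear_combination (t * α + v : K) ^ 2 * h' -
      (t * (α ^ 2 - 2) + v) * ((t * α + v) * β + s * α + u) * h)
  have h1 := congrFun hcoeffs 1
  have h2 := congrFun hcoeffs 2
  have h3 := congrFun hcoeffs 3
  have h4 := congrFun hcoeffs 4
  simp only [Matrix.cons_val, Pi.zero_apply] at h1 h2 h3 h4
  obtain rfl : t = 0 := eq_zero_of_mul_eq_zero_of_det_ne_zero hM (by linear_combination h4)
    (by linear_combination h3 / 2)
  obtain ⟨hs0, hv0⟩ : s ≠ 0 ∧ v ≠ 0 := mul_ne_zero_iff.1 (by simpa using hM)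
  have hu0 : u = 0 := mul_left_cancel₀ (mul_ne_zero hv0 hs0) (by linear_combination h1 / 2)
  have hsv : s = v := mul_left_cancel₀ (mul_ne_zero hv0 hs0) (by linear_combination h2)
  ext i j
  fin_cases i <;> fin_cases j <;> simp [hs, hu, ht, hv, hu0, hsv]

theorem IsMoebiusImage.diag_or_antidiag_of_neg (hα : 3 ≤ (minpoly ℚ α).natDegree)
    (hM : M.det ≠ 0) (h : IsMoebiusImage M α β) (h' : IsMoebiusImage M (-α) (-β)) :
    (M 0 1 = 0 ∧ M 1 0 = 0) ∨ (M 0 0 = 0 ∧ M 1 1 = 0) := by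
  obtain ⟨hst, -, huv⟩ := coeffs_eq_zero_of_quadratic_eq_zero (α := α) hα
    (a := M 0 0 * M 1 0) (b := 0) (c := -(M 0 1 * M 1 1)) (by
      unfold IsMoebiusImage at h h'
      push_cast
      linear_combination (1 / 2) * (M 1 0 * α + M 1 1 : K) * h' +
        (1 / 2) * (-M 1 0 * α + M 1 1 : K) * h)
  rw [Matrix.det_fin_two] at hM
  rcases mul_eq_zero.1 hst with hs | ht
  · have hu : M 0 1 ≠ 0 := fun hu => hM (by rw [hs, hu, zero_mul, zero_mul, sub_zero])
    exact .inr ⟨hs, by simpa [hu] using huv⟩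
  · have hv : M 1 1 ≠ 0 := fun hv => hM (by rw [ht, hv, mul_zero, mul_zero, sub_zero])
    exact .inl ⟨by simpa [hv] using huv, ht⟩

end Moebius

section SmallGroups

variable {F : MvPolynomial (Fin 2) ℚ} {d : ℕ} {S : Set (Matrix (Fin 2) (Fin 2) ℚ)}

theorem matrixGroup_singleton (g : GL (Fin 2) ℚ) :
    matrixGroup {(g : Matrix (Fin 2) (Fin 2) ℚ)} =
      Set.range fun k : ℤ => ((g ^ k : GL (Fin 2) ℚ) : Matrix (Fin 2) (Fin 2) ℚ) := by
  have hg : {h : GL (Fin 2) ℚ | (h : Matrix (Fin 2) (Fin 2) ℚ) ∈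
      ({(g : Matrix (Fin 2) (Fin 2) ℚ)} : Set _)} = {g} :=
    Set.ext fun _ => Units.val_inj
  rw [matrixGroup, hg, ← Subgroup.zpowers_eq_closure, Subgroup.coe_zpowers, ← Set.range_comp]
  rfl

theorem groupC1_eq : groupC1 = {1} := by
  rw [groupC1, ← Matrix.one_fin_two, ← Units.val_one, matrixGroup_singleton]
  simp

theorem groupC2_eq : groupC2 = {1, -1} := by
  have hneg : (!![-1, 0; 0, -1] : Matrix (Fin 2) (Fin 2) ℚ) = (-1 : GL (Fin 2) ℚ) := by
    decide +kernel
  rw [groupC2, hneg, matrixGroup_singleton]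
  refine Set.Subset.antisymm ?_ (Set.pair_subset ⟨0, by simp⟩ ⟨1, by simp⟩)
  rintro _ ⟨k, rfl⟩
  rcases k.even_or_odd with hk | hk
  · exact .inl (by simp [hk.neg_one_zpow])
  · exact .inr (by simp [hk.neg_one_zpow])

theorem formAut_eq_and_formAutAbs_eq (hS : S ⊆ formAut F) (h : formAutAbs F ⊆ matrixGroup S) :
    formAut F = matrixGroup S ∧ formAutAbs F = matrixGroup S :=
  have hSF := matrixGroup_subset_formAut hS
  ⟨((formAut_subset_formAutAbs F).trans h).antisymm hSF,
    h.antisymm (hSF.trans (formAut_subset_formAutAbs F))⟩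

theorem one_mem_formAut (F : MvPolynomial (Fin 2) ℚ) : 1 ∈ formAut F :=
  formSubst_one F

theorem neg_one_mem_formAut_of_even (hF : F.IsHomogeneous d) (hd : Even d) : -1 ∈ formAut F :=
  (formSubst_neg_of_even hF hd 1).trans (formSubst_one F)

theorem neg_one_mem_formAutAbs (hF : F.IsHomogeneous d) : -1 ∈ formAutAbs F := by
  rcases d.even_or_odd with hd | hd
  · exact .inl (neg_one_mem_formAut_of_even hF hd)
  · exact .inr (by rw [formSubst_neg_of_odd hF hd, formSubst_one])

theorem neg_notMem_formAut_of_odd (hF : F.IsHomogeneous d) (hd : Odd d) (hF0 : F ≠ 0)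
    {M : Matrix (Fin 2) (Fin 2) ℚ} (hM : M ∈ formAut F) : -M ∉ formAut F := fun h => by
  have hFF : -F = F := by
    nth_rewrite 1 [← show formSubst F M = F from hM]
    rw [← formSubst_neg_of_odd hF hd, show formSubst F (-M) = F from h]
  exact hF0 (self_eq_neg.1 hFF.symm)

theorem formAut_eq_of_formAutAbs_eq_of_even (hF : F.IsHomogeneous d) (hd : Even d)
    (h : formAutAbs F = {1, -1}) : formAut F = {1, -1} :=
  (h ▸ formAut_subset_formAutAbs F).antisymm
    (Set.pair_subset (one_mem_formAut F) (neg_one_mem_formAut_of_even hF hd))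

theorem formAut_eq_of_formAutAbs_eq_of_odd (hF : F.IsHomogeneous d) (hd : Odd d) (hF0 : F ≠ 0)
    (h : formAutAbs F = {1, -1}) : formAut F = {1} := by
  refine (Set.singleton_subset_iff.2 (one_mem_formAut F)).antisymm' fun M hM => ?_
  rcases h ▸ formAut_subset_formAutAbs F hM with rfl | rfl
  · rfl
  · exact absurd hM (neg_notMem_formAut_of_odd hF hd hF0 (one_mem_formAut F))

end SmallGroups

theorem minpolyForm_ne_zero {K : Type*} [Field K] [CharZero K] {α : K}
    (hα : 2 ≤ (minpoly ℚ α).natDegree) : minpolyForm α ≠ 0 := fun h => by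
  have h1 := (isAnisotropicForm_minpolyForm hα ![1, 0]).1 (by rw [h, map_zero])
  simpa using congrFun h1 0

theorem signFlip_mem_formAut_minpolyForm {K : Type*} [Field K] [CharZero K] {α : K}
    (hd : Even (minpoly ℚ α).natDegree) {τ : K ≃ₐ[ℚ] K} (hτ : τ α = -α) :
    (signFlip : Matrix (Fin 2) (Fin 2) ℚ) ∈ formAut (minpolyForm α) := by
  have h := minpolyForm_neg α
  rw [hd.neg_one_pow, one_smul, ← hτ, minpolyForm, minpoly.algEquiv_eq] at h
  exact h.symm

theorem IsAnisotropicForm.mem_matrixGroup_of_diag {F : MvPolynomial (Fin 2) ℚ} {d : ℕ}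
    (hF : IsAnisotropicForm F) (hFd : F.IsHomogeneous d) (hd : d ≠ 0)
    {M : Matrix (Fin 2) (Fin 2) ℚ} (hM : M ∈ formAutAbs F) (hu : M 0 1 = 0) (ht : M 1 0 = 0) :
    M ∈ matrixGroup {!![-1, 0; 0, 1], !![1, 0; 0, -1]} := by
  have hs : M 0 0 = 1 ∨ M 0 0 = -1 :=
    hF.eigenvalue_eq_one_or_eq_neg_one hFd hd hM (x := ![1, 0]) (by simp)
      (by ext i; fin_cases i <;> simp [Matrix.mulVec, dotProduct, ht])
  have hv : M 1 1 = 1 ∨ M 1 1 = -1 :=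
    hF.eigenvalue_eq_one_or_eq_neg_one hFd hd hM (x := ![0, 1]) (by simp)
      (by ext i; fin_cases i <;> simp [Matrix.mulVec, dotProduct, hu])
  set S : Set (Matrix (Fin 2) (Fin 2) ℚ) := {!![-1, 0; 0, 1], !![1, 0; 0, -1]}
  have hJ : !![-1, 0; 0, 1] ∈ matrixGroup S :=
    mem_matrixGroup_of_isUnit (.inl rfl) (isUnit_of_det_ne_zero (by simp))
  have hJ' : !![1, 0; 0, -1] ∈ matrixGroup S :=
    mem_matrixGroup_of_isUnit (.inr rfl) (isUnit_of_det_ne_zero (by simp))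
  rw [Matrix.eta_fin_two M, hu, ht]
  rcases hs with hs | hs <;> rcases hv with hv | hv <;> rw [hs, hv]
  · rw [← Matrix.one_fin_two]
    exact one_mem_matrixGroup
  · exact hJ'
  · exact hJ
  · simpa using mul_mem_matrixGroup hJ hJ'

section Abelian

variable {K : Type*} [Field K] [CharZero K] [IsAbelianGalois ℚ K] {α : K}
  {M : Matrix (Fin 2) (Fin 2) ℚ}

theorem algEquiv_apply_comm (σ τ : K ≃ₐ[ℚ] K) (x : K) : σ (τ x) = τ (σ x) :=
  DFunLike.congr_fun (mul_comm' σ τ) x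

theorem exists_algEquiv_isMoebiusImage (hα : 2 ≤ (minpoly ℚ α).natDegree)
    (hM : M ∈ formAutAbs (minpolyForm α)) : ∃ σ : K ≃ₐ[ℚ] K, IsMoebiusImage M α (σ α) := by
  obtain ⟨β, hβ, hMβ⟩ := exists_root_isMoebiusImage hα hM
  obtain ⟨σ, rfl⟩ := minpoly.exists_algEquiv_of_root' (Algebra.IsAlgebraic.isAlgebraic α) hβ
  exact ⟨σ, hMβ⟩

theorem formAutAbs_minpolyForm_of_sq_sub_two (hα : 5 ≤ (minpoly ℚ α).natDegree)
    {τ : K ≃ₐ[ℚ] K} (hτ : τ α = α ^ 2 - 2) : formAutAbs (minpolyForm α) = {1, -1} := by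
  have hF : IsAnisotropicForm (minpolyForm α) := isAnisotropicForm_minpolyForm (by omega)
  have hFd := isHomogeneous_minpolyForm α
  have hone := formAut_subset_formAutAbs _ (one_mem_formAut (minpolyForm α))
  refine Set.Subset.antisymm (fun M hM => ?_) (Set.pair_subset hone (neg_one_mem_formAutAbs hFd))
  obtain ⟨σ, hσ⟩ := exists_algEquiv_isMoebiusImage (by omega) hM
  have hτσ : IsMoebiusImage M (α ^ 2 - 2) (σ α ^ 2 - 2) := by
    have h : IsMoebiusImage M (τ α) (τ (σ α)) := hσ.map τ.toAlgHom
    rwa [← algEquiv_apply_comm, hτ, map_sub, map_pow, map_ofNat] at h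
  have hM1 := hσ.eq_smul_one_of_sq_sub_two hα (hF.det_ne_zero hM) hτσ
  rcases hF.eq_one_or_eq_neg_one_of_smul_mem hFd (by omega) hone (hM1 ▸ hM) with h | h
  · exact .inl (by rw [hM1, h, one_smul])
  · exact .inr (by rw [Set.mem_singleton_iff, hM1, h, neg_one_smul])

theorem formAut_minpolyForm_of_neg (hα : 3 ≤ (minpoly ℚ α).natDegree)
    (hd : Even (minpoly ℚ α).natDegree) {τ : K ≃ₐ[ℚ] K} (hτ : τ α = -α)
    (hinv : ∀ (σ : K ≃ₐ[ℚ] K) (c : ℚ), α * σ α ≠ c) :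
    formAut (minpolyForm α) = matrixGroup {!![-1, 0; 0, 1], !![1, 0; 0, -1]} ∧
      formAutAbs (minpolyForm α) = matrixGroup {!![-1, 0; 0, 1], !![1, 0; 0, -1]} := by
  have hF : IsAnisotropicForm (minpolyForm α) := isAnisotropicForm_minpolyForm (by omega)
  have hFd := isHomogeneous_minpolyForm α
  have hJ := signFlip_mem_formAut_minpolyForm hd hτ
  have hJ' : -(signFlip : Matrix (Fin 2) (Fin 2) ℚ) ∈ formAut (minpolyForm α) :=
    (formSubst_neg_of_even hFd hd _).trans hJ
  have hnegJ : -(signFlip : Matrix (Fin 2) (Fin 2) ℚ) = !![1, 0; 0, -1] := by decide +kernel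
  refine formAut_eq_and_formAutAbs_eq (Set.pair_subset hJ (hnegJ ▸ hJ')) fun M hM => ?_
  obtain ⟨σ, hσ⟩ := exists_algEquiv_isMoebiusImage (by omega) hM
  have hτσ : IsMoebiusImage M (-α) (-σ α) := by
    have h : IsMoebiusImage M (τ α) (τ (σ α)) := hσ.map τ.toAlgHom
    rwa [← algEquiv_apply_comm, hτ, map_neg] at h
  have hdet := hF.det_ne_zero hM
  rcases hσ.diag_or_antidiag_of_neg hα hdet hτσ with ⟨hu, ht⟩ | ⟨hs, hv⟩
  · exact hF.mem_matrixGroup_of_diag hFd (by omega) hM hu ht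
  · have ht : M 1 0 ≠ 0 := fun ht => hdet (by simp [Matrix.det_fin_two, hs, ht])
    refine absurd ?_ (hinv σ (M 0 1 / M 1 0))
    have ht' : (M 1 0 : K) ≠ 0 := mod_cast ht
    push_cast
    rw [eq_div_iff ht']
    simp only [IsMoebiusImage, hs, hv, Rat.cast_zero] at hσ
    linear_combination hσ

end Abelian

section StandardGroups

theorem GLConjugate.matrixGroup_of_intertwines {P : Matrix (Fin 2) (Fin 2) ℚ} (hP : P.det ≠ 0)
    {S T : Set (Matrix (Fin 2) (Fin 2) ℚ)} (h : (P * ·) '' T = (· * P) '' S) :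
    GLConjugate (matrixGroup S) (matrixGroup T) := by
  obtain ⟨g, rfl⟩ := isUnit_of_det_ne_zero hP
  have hS : S = matrixConj g '' T := by
    calc S = (· * (g⁻¹ : GL (Fin 2) ℚ).val) '' ((· * g.val) '' S) := by
          simp [Set.image_image, mul_assoc]
      _ = matrixConj g '' T := by
          rw [← h, Set.image_image]
          rfl
  rw [hS]
  exact GLConjugate.matrixGroup_image g T

theorem glConjugate_groupC3 : GLConjugate (matrixGroup {!![-1, -1; 1, 0]}) groupC3 :=
  .matrixGroup_of_intertwines (P := !![0, 1; 1, 0]) (by simp) (by simp)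

theorem glConjugate_groupC3' : GLConjugate (matrixGroup {!![-1, 1; -1, 0]}) groupC3 :=
  .matrixGroup_of_intertwines (P := !![0, -1; 1, 0]) (by simp) (by simp)

theorem glConjugate_groupC4 : GLConjugate (matrixGroup {!![-1, 2; -1, 1]}) groupC4 :=
  .matrixGroup_of_intertwines (P := !![-1, 1; -1, 0]) (by simp) (by norm_num)

theorem glConjugate_groupC4' : GLConjugate (matrixGroup {!![1, 2; -1, -1]}) groupC4 :=
  .matrixGroup_of_intertwines (P := !![1, -1; 0, 1]) (by simp) (by norm_num)

theorem matrixGroup_pair_neg_one {A : Matrix (Fin 2) (Fin 2) ℚ} (hA : A ^ 3 = 1) :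
    matrixGroup {A, -1} = matrixGroup {-A} := by
  have hunit : IsUnit A := IsUnit.of_pow_eq_one hA three_ne_zero
  have hneg : -A ∈ matrixGroup {-A} := mem_matrixGroup_of_isUnit rfl hunit.neg
  have hsq : A ^ 2 ∈ matrixGroup {-A} := by simpa [sq] using mul_mem_matrixGroup hneg hneg
  refine matrixGroup_eq_of_subset (Set.pair_subset ?_ ?_) (Set.singleton_subset_iff.2 ?_)
  · have hA4 : A ^ 2 * A ^ 2 = A := by rw [← pow_add, pow_succ, hA, one_mul]
    simpa only [hA4] using mul_mem_matrixGroup hsq hsq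
  · have hA3 : A ^ 2 * -A = -1 := by rw [mul_neg, ← pow_succ, hA]
    simpa only [hA3] using mul_mem_matrixGroup hsq hneg
  · simpa using mul_mem_matrixGroup (mem_matrixGroup_of_isUnit (Set.mem_insert A {-1}) hunit)
      (mem_matrixGroup_of_isUnit (.inr rfl) isUnit_one.neg)

theorem matrixGroup_pair_neg {A : Matrix (Fin 2) (Fin 2) ℚ} (hA : A ^ 2 = 1) :
    matrixGroup {A, -A} = matrixGroup {A, -1} := by
  have hunit : IsUnit A := IsUnit.of_pow_eq_one hA two_ne_zero
  have hmem (B) : A ∈ matrixGroup {A, B} := mem_matrixGroup_of_isUnit (.inl rfl) hunit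
  refine matrixGroup_eq_of_subset (Set.pair_subset (hmem _) ?_) (Set.pair_subset (hmem _) ?_)
  · simpa using mul_mem_matrixGroup (hmem _)
      (mem_matrixGroup_of_isUnit (.inr rfl) isUnit_one.neg)
  · have hAA : A * -A = -1 := by rw [mul_neg, ← sq, hA]
    simpa only [hAA] using mul_mem_matrixGroup (hmem _)
      (mem_matrixGroup_of_isUnit (.inr rfl) hunit.neg)

theorem matrixGroup_neg_of_sq_eq_neg_one {A : Matrix (Fin 2) (Fin 2) ℚ} (hA : A ^ 2 = -1) :
    matrixGroup {-A} = matrixGroup {A} := by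
  have hunit : IsUnit A := isUnit_of_mul_isUnit_left (sq A ▸ hA ▸ isUnit_one.neg)
  have hcube : A * A * A = -A := by rw [← sq, hA, neg_one_mul]
  have hA_mem : A ∈ matrixGroup {A} := mem_matrixGroup_of_isUnit rfl hunit
  have hneg_mem : -A ∈ matrixGroup {-A} := mem_matrixGroup_of_isUnit rfl hunit.neg
  refine matrixGroup_eq_of_subset (Set.singleton_subset_iff.2 ?_) (Set.singleton_subset_iff.2 ?_)
  · exact hcube ▸ mul_mem_matrixGroup (mul_mem_matrixGroup hA_mem hA_mem) hA_mem
  · simpa [hcube] using mul_mem_matrixGroup (mul_mem_matrixGroup hneg_mem hneg_mem) hneg_mem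

theorem neg_one_fin_two : (!![-1, 0; 0, -1] : Matrix (Fin 2) (Fin 2) ℚ) = -1 := by
  decide +kernel

theorem glConjugate_groupC6 :
    GLConjugate (matrixGroup {!![-1, -1; 1, 0], !![-1, 0; 0, -1]}) groupC6 := by
  rw [neg_one_fin_two, matrixGroup_pair_neg_one (by decide +kernel)]
  exact .matrixGroup_of_intertwines (P := !![0, 1; 1, 0]) (by simp) (by simp)

theorem glConjugate_groupC6' :
    GLConjugate (matrixGroup {!![-1, 1; -1, 0], !![-1, 0; 0, -1]}) groupC6 := by
  rw [neg_one_fin_two, matrixGroup_pair_neg_one (by decide +kernel)]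
  exact .matrixGroup_of_intertwines (P := !![0, -1; 1, 0]) (by simp) (by simp)

theorem glConjugate_groupD2 :
    GLConjugate (matrixGroup {!![-1, 0; 0, 1], !![1, 0; 0, -1]}) groupD2 := by
  have hneg : (!![1, 0; 0, -1] : Matrix (Fin 2) (Fin 2) ℚ) = -!![-1, 0; 0, 1] := by
    decide +kernel
  rw [hneg, matrixGroup_pair_neg (by decide +kernel), ← neg_one_fin_two]
  exact .matrixGroup_of_intertwines (P := !![1, -1; 1, 1]) (by norm_num) (by simp [Set.image_pair])

end StandardGroups

theorem roots_of_simplest_cubic {K : Type*} [Field K] {a α β : K}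
    (hα : α ^ 3 + a * α ^ 2 + (a - 3) * α - 1 = 0) (hβ : β ^ 3 + a * β ^ 2 + (a - 3) * β - 1 = 0) :
    β = α ∨ α * β = -α - 1 ∨ (-α - 1) * β = 1 := by
  have hprod : (β - α) * ((α * β - (-α - 1)) * ((-α - 1) * β - 1)) = 0 := by
    linear_combination (β ^ 2 + β) * hα - (α ^ 2 + α) * hβ
  simpa only [mul_eq_zero, sub_eq_zero] using hprod

section LowDegree

variable {K : Type*} [Field K] [CharZero K] {α β : K}
  {F : MvPolynomial (Fin 2) ℚ} {d : ℕ} {S : Set (Matrix (Fin 2) (Fin 2) ℚ)}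
  {A M : Matrix (Fin 2) (Fin 2) ℚ}

theorem formAut_eq_matrixGroup_of_even (hS : S ⊆ formAut F) (hneg : -1 ∈ matrixGroup S)
    (h : ∀ M ∈ formAutAbs F, ∃ N ∈ matrixGroup S, M = N ∨ M = -N) :
    formAut F = matrixGroup S ∧ formAutAbs F = matrixGroup S := by
  refine formAut_eq_and_formAutAbs_eq hS fun M hM => ?_
  obtain ⟨N, hN, rfl | rfl⟩ := h M hM
  · exact hN
  · simpa using mul_mem_matrixGroup hneg hN

theorem formAut_eq_matrixGroup_of_odd (hF : F.IsHomogeneous d) (hd : Odd d) (hF0 : F ≠ 0)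
    (hA : A ∈ formAut F) (hA' : IsUnit A)
    (h : ∀ M ∈ formAutAbs F, ∃ N ∈ matrixGroup {A}, M = N ∨ M = -N) :
    formAut F = matrixGroup {A} ∧ formAutAbs F = matrixGroup {A, -1} := by
  have hAF : matrixGroup {A} ⊆ formAut F :=
    matrixGroup_subset_formAut (Set.singleton_subset_iff.2 hA)
  refine ⟨hAF.antisymm' fun M hM => ?_, Set.Subset.antisymm (fun M hM => ?_)
    (matrixGroup_subset_formAutAbs (Set.pair_subset (.inl hA) (neg_one_mem_formAutAbs hF)))⟩
  · obtain ⟨N, hN, rfl | rfl⟩ := h M (formAut_subset_formAutAbs F hM)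
    · exact hN
    · exact absurd hM (neg_notMem_formAut_of_odd hF hd hF0 (hAF hN))
  · have hneg : -1 ∈ matrixGroup {A, -1} := mem_matrixGroup_of_isUnit (.inr rfl) isUnit_one.neg
    have hAA : matrixGroup {A} ⊆ matrixGroup {A, -1} := matrixGroup_subset_matrixGroup
      (Set.singleton_subset_iff.2 (mem_matrixGroup_of_isUnit (.inl rfl) hA'))
    obtain ⟨N, hN, rfl | rfl⟩ := h M hM
    · exact hAA hN
    · simpa using mul_mem_matrixGroup hneg (hAA hN)

theorem exists_eq_or_eq_neg_of_isMoebiusImage (hα : 3 ≤ (minpoly ℚ α).natDegree)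
    (hS : S ⊆ formAut (minpolyForm α)) (hM : M ∈ formAutAbs (minpolyForm α))
    (hMβ : IsMoebiusImage M α β) (hβ : ∃ N ∈ matrixGroup S, IsMoebiusImage N α β) :
    ∃ N ∈ matrixGroup S, M = N ∨ M = -N := by
  obtain ⟨N, hN, hNβ⟩ := hβ
  exact ⟨N, hN, eq_or_eq_neg_of_isMoebiusImage hα hM
    (.inl (matrixGroup_subset_formAut hS hN)) hMβ hNβ⟩

theorem mem_formAut_of_eval (h : ∀ x y : ℚ,
    MvPolynomial.eval ![M 0 0 * x + M 0 1 * y, M 1 0 * x + M 1 1 * y] F =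
      MvPolynomial.eval ![x, y] F) : M ∈ formAut F := by
  refine MvPolynomial.funext fun x => ?_
  have hx : x = ![x 0, x 1] := by ext i; fin_cases i <;> rfl
  have hMx : M *ᵥ x = ![M 0 0 * x 0 + M 0 1 * x 1, M 1 0 * x 0 + M 1 1 * x 1] := by
    ext i
    fin_cases i <;> simp [Matrix.mulVec, dotProduct]
  rw [eval_formSubst, hMx, h, ← hx]

open Polynomial in
theorem eval_minpolyForm_of_cubic {a b c : ℚ}
    (hα : minpoly ℚ α = X ^ 3 + C a * X ^ 2 + C b * X + C c) (x y : ℚ) :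
    MvPolynomial.eval ![x, y] (minpolyForm α) =
      x ^ 3 + a * x ^ 2 * y + b * x * y ^ 2 + c * y ^ 3 := by
  have hdeg : (minpoly ℚ α).natDegree = 3 := by
    rw [hα]
    compute_degree!
  rw [minpolyForm, hdeg, hα]
  simp [homogenize_add, mul_assoc]

open Polynomial in
theorem eval_minpolyForm_of_quartic {a b c e : ℚ}
    (hα : minpoly ℚ α = X ^ 4 + C a * X ^ 3 + C b * X ^ 2 + C c * X + C e) (x y : ℚ) :
    MvPolynomial.eval ![x, y] (minpolyForm α) =
      x ^ 4 + a * x ^ 3 * y + b * x ^ 2 * y ^ 2 + c * x * y ^ 3 + e * y ^ 4 := by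
  have hdeg : (minpoly ℚ α).natDegree = 4 := by
    rw [hα]
    compute_degree!
  rw [minpolyForm, hdeg, hα]
  simp [homogenize_add, mul_assoc]

open Polynomial in
theorem formAut_minpolyForm_of_simplest_cubic {a : ℚ}
    (hα : minpoly ℚ α = X ^ 3 + C a * X ^ 2 + C (a - 3) * X - 1) :
    formAut (minpolyForm α) = matrixGroup {!![-1, -1; 1, 0]} ∧
      formAutAbs (minpolyForm α) = matrixGroup {!![-1, -1; 1, 0], !![-1, 0; 0, -1]} := by
  have hdeg : (minpoly ℚ α).natDegree = 3 := by
    rw [hα]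
    compute_degree!
  have heval := eval_minpolyForm_of_cubic (α := α) (a := a) (b := a - 3) (c := -1)
    (by rw [hα]; simp [sub_eq_add_neg])
  have hA : !![-1, -1; 1, 0] ∈ formAut (minpolyForm α) :=
    mem_formAut_of_eval fun x y => by
      simp only [Matrix.of_apply, Matrix.cons_val', Matrix.cons_val_zero, Matrix.cons_val_one,
        Matrix.cons_val_fin_one, heval]
      ring
  have hunit : IsUnit (!![-1, -1; 1, 0] : Matrix (Fin 2) (Fin 2) ℚ) :=
    isUnit_of_det_ne_zero (by simp)
  have hAmem := mem_matrixGroup_of_isUnit (Set.mem_singleton _) hunit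
  have hroot {x : K} (hx : aeval x (minpoly ℚ α) = 0) :
      x ^ 3 + a * x ^ 2 + (a - 3) * x - 1 = 0 := by
    rw [hα] at hx
    simpa [sub_eq_add_neg] using hx
  rw [neg_one_fin_two]
  refine formAut_eq_matrixGroup_of_odd (isHomogeneous_minpolyForm α) (by rw [hdeg]; decide)
    (minpolyForm_ne_zero (by omega)) hA hunit fun M hM => ?_
  obtain ⟨β, hβ, hMβ⟩ := exists_root_isMoebiusImage (by omega) hM
  refine exists_eq_or_eq_neg_of_isMoebiusImage hdeg.ge (Set.singleton_subset_iff.2 hA) hM hMβ ?_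
  rcases roots_of_simplest_cubic (hroot (minpoly.aeval ℚ α)) (hroot hβ) with h | h | h
  · exact ⟨1, one_mem_matrixGroup, by simpa [IsMoebiusImage] using h⟩
  · exact ⟨_, hAmem, by simpa [IsMoebiusImage, sub_eq_add_neg] using h⟩
  · exact ⟨_, mul_mem_matrixGroup hAmem hAmem, by simpa [IsMoebiusImage, sub_eq_add_neg] using h⟩

theorem not_isMoebiusImage_of_cubic (hα : 4 ≤ (minpoly ℚ α).natDegree) (hM : M.det ≠ 0)
    {p q : Fin 4 → ℚ} (hp : β = p 0 + p 1 * α + p 2 * α ^ 2 + p 3 * α ^ 3)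
    (hq : α * β = q 0 + q 1 * α + q 2 * α ^ 2 + q 3 * α ^ 3) (hpq : p 2 * q 3 - p 3 * q 2 ≠ 0) :
    ¬ IsMoebiusImage M α β := fun h => by
  have hcoeffs := coeffs_eq_zero_of_sum_pow_eq_zero hα
    (a := M 1 0 • q + M 1 1 • p - ![M 0 1, M 0 0, 0, 0]) (by
      simp only [IsMoebiusImage] at h
      simp only [Pi.sub_apply, Pi.add_apply, Pi.smul_apply, smul_eq_mul, Fin.sum_univ_four,
        Matrix.cons_val, Fin.coe_ofNat_eq_mod, Nat.reduceMod]
      push_cast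
      linear_combination h - M 1 0 * hq - M 1 1 * hp)
  have h2 : M 1 0 * q 2 + M 1 1 * p 2 = 0 := by simpa using congrFun hcoeffs 2
  have h3 : M 1 0 * q 3 + M 1 1 * p 3 = 0 := by simpa using congrFun hcoeffs 3
  have ht : M 1 0 = 0 := (mul_eq_zero.1 (by linear_combination p 2 * h3 - p 3 * h2 :
    M 1 0 * (p 2 * q 3 - p 3 * q 2) = 0)).resolve_right hpq
  have hv : M 1 1 = 0 := (mul_eq_zero.1 (by linear_combination q 3 * h2 - q 2 * h3 :
    M 1 1 * (p 2 * q 3 - p 3 * q 2) = 0)).resolve_right hpq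
  exact hM (by rw [Matrix.det_fin_two, ht, hv, mul_zero, mul_zero, sub_zero])

theorem roots_of_quartic_fifteen {K : Type*} [Field K] {α β : K}
    (hα : α ^ 4 - α ^ 3 - 4 * α ^ 2 + 4 * α + 1 = 0)
    (hβ : β ^ 4 - β ^ 3 - 4 * β ^ 2 + 4 * β + 1 = 0) :
    β = α ∨ β = α ^ 2 - 2 ∨ β = α ^ 3 - 4 * α + 1 ∨ β = -α ^ 3 - α ^ 2 + 3 * α + 2 := by
  have hprod : (β - α) * ((β - (α ^ 2 - 2)) *
      ((β - (α ^ 3 - 4 * α + 1)) * (β - (-α ^ 3 - α ^ 2 + 3 * α + 2)))) = 0 := by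
    linear_combination hβ + (-α ^ 5 + α ^ 4 * β - 2 * α ^ 4 + 3 * α ^ 3 * β + 3 * α ^ 3 -
      α ^ 2 * β ^ 2 - α ^ 2 * β + 6 * α ^ 2 - 2 * α * β ^ 2 - 6 * α * β - 1) * hα
  simpa only [mul_eq_zero, sub_eq_zero] using hprod

theorem exists_isMoebiusImage_of_quartic_fifteen (hdeg : 4 ≤ (minpoly ℚ α).natDegree)
    (hα : α ^ 4 - α ^ 3 - 4 * α ^ 2 + 4 * α + 1 = 0)
    (hβ : β ^ 4 - β ^ 3 - 4 * β ^ 2 + 4 * β + 1 = 0)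
    (hdet : M.det ≠ 0) (hMβ : IsMoebiusImage M α β) :
    ∃ N ∈ matrixGroup {!![-1, 2; -1, 1]}, IsMoebiusImage N α β := by
  rcases roots_of_quartic_fifteen hα hβ with rfl | h | rfl | h
  · exact ⟨1, one_mem_matrixGroup, by simp [IsMoebiusImage]⟩
  · refine absurd hMβ (not_isMoebiusImage_of_cubic hdeg hdet (p := ![-2, 0, 1, 0])
      (q := ![0, -2, 0, 1]) ?_ ?_ (by simp)) <;> simp [h] <;> ring
  · refine ⟨_, mem_matrixGroup_of_isUnit rfl (isUnit_of_det_ne_zero (by norm_num)), ?_⟩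
    simp only [IsMoebiusImage, Matrix.of_apply, Matrix.cons_val', Matrix.cons_val_zero,
      Matrix.cons_val_fin_one, Matrix.cons_val_one]
    push_cast
    linear_combination -hα
  · refine absurd hMβ (not_isMoebiusImage_of_cubic hdeg hdet (p := ![2, 3, -1, -1])
      (q := ![1, 6, -1, -2]) ?_ ?_ (by simp; norm_num)) <;> simp [h]
    · ring
    · linear_combination -hα

open Polynomial in
theorem formAut_minpolyForm_of_quartic_fifteen
    (hα : minpoly ℚ α = X ^ 4 - X ^ 3 - 4 * X ^ 2 + 4 * X + 1) :
    formAut (minpolyForm α) = matrixGroup {!![-1, 2; -1, 1]} ∧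
      formAutAbs (minpolyForm α) = matrixGroup {!![-1, 2; -1, 1]} := by
  have hdeg : (minpoly ℚ α).natDegree = 4 := by
    rw [hα]
    compute_degree!
  have heval := eval_minpolyForm_of_quartic (α := α) (a := -1) (b := -4) (c := 4) (e := 1)
    (by rw [hα]; simp [sub_eq_add_neg, map_ofNat])
  have hA : !![-1, 2; -1, 1] ∈ formAut (minpolyForm α) :=
    mem_formAut_of_eval fun x y => by
      simp only [Matrix.of_apply, Matrix.cons_val', Matrix.cons_val_zero, Matrix.cons_val_one,
        Matrix.cons_val_fin_one, heval]
      ring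
  have hAmem : !![-1, 2; -1, 1] ∈ matrixGroup {!![-1, 2; -1, 1]} :=
    mem_matrixGroup_of_isUnit rfl (isUnit_of_det_ne_zero (by norm_num))
  have hsq : (!![-1, 2; -1, 1] * !![-1, 2; -1, 1] : Matrix (Fin 2) (Fin 2) ℚ) = -1 := by
    decide +kernel
  have hroot {x : K} (hx : aeval x (minpoly ℚ α) = 0) :
      x ^ 4 - x ^ 3 - 4 * x ^ 2 + 4 * x + 1 = 0 := by
    rw [hα] at hx
    simpa [sub_eq_add_neg, map_ofNat] using hx
  refine formAut_eq_matrixGroup_of_even (Set.singleton_subset_iff.2 hA)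
    (hsq ▸ mul_mem_matrixGroup hAmem hAmem) fun M hM => ?_
  have hdet := (isAnisotropicForm_minpolyForm (by omega)).det_ne_zero hM
  obtain ⟨β, hβ, hMβ⟩ := exists_root_isMoebiusImage (by omega) hM
  exact exists_eq_or_eq_neg_of_isMoebiusImage (by omega) (Set.singleton_subset_iff.2 hA) hM hMβ
    (exists_isMoebiusImage_of_quartic_fifteen hdeg.ge (hroot (minpoly.aeval ℚ α)) (hroot hβ)
      hdet hMβ)

theorem roots_of_palindromic_quartic {K : Type*} [Field K] {b α β : K}
    (hα : α ^ 4 + b * α ^ 2 + 1 = 0) (hβ : β ^ 4 + b * β ^ 2 + 1 = 0) :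
    β = α ∨ β = -α ∨ α * β = 1 ∨ α * β = -1 := by
  have hprod : (β - α) * ((β - -α) * ((α * β - 1) * (α * β - -1))) = 0 := by
    linear_combination α ^ 2 * hβ - β ^ 2 * hα
  simpa only [mul_eq_zero, sub_eq_zero] using hprod

open Polynomial in
theorem formAut_minpolyForm_of_palindromic_quartic {b : ℚ}
    (hα : minpoly ℚ α = X ^ 4 + C b * X ^ 2 + 1) :
    formAut (minpolyForm α) = groupD4 ∧ formAutAbs (minpolyForm α) = groupD4 := by
  have hdeg : (minpoly ℚ α).natDegree = 4 := by
    rw [hα]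
    compute_degree!
  have heval := eval_minpolyForm_of_quartic (α := α) (a := 0) (b := b) (c := 0) (e := 1)
    (by rw [hα]; simp)
  have hswap : !![0, 1; 1, 0] ∈ formAut (minpolyForm α) :=
    mem_formAut_of_eval fun x y => by
      simp only [Matrix.of_apply, Matrix.cons_val', Matrix.cons_val_zero, Matrix.cons_val_one,
        Matrix.cons_val_fin_one, heval]
      ring
  have hrot : !![0, 1; -1, 0] ∈ formAut (minpolyForm α) :=
    mem_formAut_of_eval fun x y => by
      simp only [Matrix.of_apply, Matrix.cons_val', Matrix.cons_val_zero, Matrix.cons_val_one,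
        Matrix.cons_val_fin_one, heval]
      ring
  have hswap' : !![0, 1; 1, 0] ∈ groupD4 :=
    mem_matrixGroup_of_isUnit (.inl rfl) (isUnit_of_det_ne_zero (by simp))
  have hrot' : !![0, 1; -1, 0] ∈ groupD4 :=
    mem_matrixGroup_of_isUnit (.inr rfl) (isUnit_of_det_ne_zero (by simp))
  have hsq : (!![0, 1; -1, 0] * !![0, 1; -1, 0] : Matrix (Fin 2) (Fin 2) ℚ) = -1 := by
    decide +kernel
  have hroot {x : K} (hx : aeval x (minpoly ℚ α) = 0) : x ^ 4 + b * x ^ 2 + 1 = 0 := by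
    rw [hα] at hx
    simpa using hx
  have hS := Set.pair_subset hswap hrot
  refine formAut_eq_matrixGroup_of_even hS (hsq ▸ mul_mem_matrixGroup hrot' hrot') fun M hM => ?_
  obtain ⟨β, hβ, hMβ⟩ := exists_root_isMoebiusImage (by omega) hM
  refine exists_eq_or_eq_neg_of_isMoebiusImage (by omega) hS hM hMβ ?_
  rcases roots_of_palindromic_quartic (hroot (minpoly.aeval ℚ α)) (hroot hβ) with h | h | h | h
  · exact ⟨1, one_mem_matrixGroup, by simpa [IsMoebiusImage] using h⟩
  · exact ⟨_, mul_mem_matrixGroup hswap' hrot', by simpa [IsMoebiusImage] using h⟩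
  · exact ⟨_, hswap', by simpa [IsMoebiusImage] using h⟩
  · exact ⟨_, hrot', by simpa [IsMoebiusImage, neg_eq_iff_eq_neg] using h⟩

end LowDegree

section Cyclotomic

theorem add_inv_eq_add_inv_iff {K : Type*} [Field K] {x y : K} (hx : x ≠ 0) (hy : y ≠ 0) :
    x + x⁻¹ = y + y⁻¹ ↔ x = y ∨ x = y⁻¹ := by
  have h : x + x⁻¹ - (y + y⁻¹) = (x - y) * (x - y⁻¹) / x := by
    field_simp
    ring
  rw [← sub_eq_zero, h, div_eq_zero_iff, mul_eq_zero, sub_eq_zero, sub_eq_zero, or_iff_left hx]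

theorem pow_half_eq_neg_one {K : Type*} [Field K] {ζ : K} {m : ℕ} (hm : m ≠ 0)
    (hζ : IsPrimitiveRoot ζ (m * 2)) : ζ ^ m = -1 :=
  (hζ.pow (by omega) rfl).eq_neg_one_of_two_right

theorem isPrimitiveRoot_neg_of_odd {K : Type*} [Field K] [CharZero K] {ζ : K} {n : ℕ} (hn : Odd n)
    (hζ : IsPrimitiveRoot ζ n) : IsPrimitiveRoot (-ζ) (2 * n) := by
  have hcop : (orderOf (-1 : K)).Coprime (orderOf ζ) := by
    simpa [← hζ.eq_orderOf, Nat.coprime_two_left] using hn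
  have horder : orderOf (-ζ) = 2 * n := by
    rw [neg_eq_neg_one_mul, (Commute.all _ _).orderOf_mul_eq_mul_orderOf_of_coprime hcop]
    simp [hζ.eq_orderOf]
  exact horder ▸ IsPrimitiveRoot.orderOf (-ζ)

variable {n : ℕ} [NeZero n] {K : Type*} [Field K] [NumberField K]
  [IsCyclotomicExtension {n} ℚ K] {ζ : K}

theorem exists_algEquiv_apply_eq_pow (hζ : IsPrimitiveRoot ζ n) {a : ℕ} (ha : a.Coprime n) :
    ∃ σ : K ≃ₐ[ℚ] K, σ ζ = ζ ^ a := by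
  have := IsCyclotomicExtension.isGalois {n} ℚ K
  have hroot : Polynomial.aeval (ζ ^ a) (minpoly ℚ ζ) = 0 := by
    rw [← Polynomial.cyclotomic_eq_minpoly_rat hζ (NeZero.pos n),
      Polynomial.cyclotomic_eq_minpoly_rat (hζ.pow_of_coprime a ha) (NeZero.pos n)]
    exact minpoly.aeval ℚ _
  exact minpoly.exists_algEquiv_of_root' (Algebra.IsAlgebraic.isAlgebraic ζ) hroot

theorem exists_algEquiv_add_inv_eq_sq_sub_two (hζ : IsPrimitiveRoot ζ n) (hn : Odd n) :
    ∃ τ : K ≃ₐ[ℚ] K, τ (ζ + ζ⁻¹) = (ζ + ζ⁻¹) ^ 2 - 2 := by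
  obtain ⟨τ, hτ⟩ := exists_algEquiv_apply_eq_pow hζ hn.coprime_two_left
  have hζ0 : ζ ≠ 0 := hζ.ne_zero (NeZero.ne n)
  refine ⟨τ, ?_⟩
  rw [map_add, map_inv₀, hτ]
  field_simp
  ring

theorem exists_algEquiv_apply_eq_inv (hζ : IsPrimitiveRoot ζ n) :
    ∃ σ : K ≃ₐ[ℚ] K, σ ζ = ζ⁻¹ := by
  obtain ⟨σ, hσ⟩ := exists_algEquiv_apply_eq_pow hζ (a := n - 1)
    (by simp [Nat.coprime_self_sub_left, NeZero.one_le])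
  exact ⟨σ, by rw [hσ, pow_sub₀ ζ (hζ.ne_zero (NeZero.ne n)) NeZero.one_le, hζ.pow_eq_one,
    one_mul, pow_one]⟩

theorem algEquiv_eq_of_apply_eq (hζ : IsPrimitiveRoot ζ n) {σ τ : K ≃ₐ[ℚ] K} (h : σ ζ = τ ζ) :
    σ = τ :=
  AlgEquiv.coe_toAlgHom_injective ((hζ.powerBasis ℚ).algHom_ext (by simpa using h))

open IntermediateField

theorem card_fixingSubgroup_adjoin_add_inv (hζ : IsPrimitiveRoot ζ n) (hn : 2 < n) :
    Nat.card (ℚ⟮ζ + ζ⁻¹⟯.fixingSubgroup) = 2 := by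
  have hζ0 : ζ ≠ 0 := hζ.ne_zero (NeZero.ne n)
  obtain ⟨ι, hι⟩ := exists_algEquiv_apply_eq_inv hζ
  have hι1 : ι ≠ 1 := by
    rintro rfl
    have hsq : ζ ^ 2 = 1 := by rwa [sq, mul_eq_one_iff_eq_inv₀ hζ0]
    exact hζ.pow_ne_one_of_pos_of_lt two_ne_zero hn hsq
  have hfix : (ℚ⟮ζ + ζ⁻¹⟯.fixingSubgroup : Set (K ≃ₐ[ℚ] K)) = {1, ι} := by
    ext τ
    calc τ ∈ ℚ⟮ζ + ζ⁻¹⟯.fixingSubgroup ↔ τ (ζ + ζ⁻¹) = ζ + ζ⁻¹ := by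
          rw [IntermediateField.mem_fixingSubgroup_iff]
          simpa using forall_mem_adjoin_smul_eq_self_iff ℚ (S := {ζ + ζ⁻¹}) τ
      _ ↔ τ ζ = ζ ∨ τ ζ = ζ⁻¹ := by
          rw [map_add, map_inv₀]
          exact add_inv_eq_add_inv_iff (by simpa using hζ0) hζ0
      _ ↔ τ = 1 ∨ τ = ι :=
          or_congr ⟨fun h => algEquiv_eq_of_apply_eq hζ h, fun h => h ▸ rfl⟩
            ⟨fun h => algEquiv_eq_of_apply_eq hζ (h.trans hι.symm), fun h => h ▸ hι⟩
  exact (congrArg Set.ncard hfix).trans (Set.ncard_pair hι1.symm)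

theorem natDegree_minpoly_add_inv (hζ : IsPrimitiveRoot ζ n) (hn : 2 < n) :
    (minpoly ℚ (ζ + ζ⁻¹)).natDegree = n.totient / 2 := by
  have := IsCyclotomicExtension.isGalois {n} ℚ K
  have hmul := Module.finrank_mul_finrank ℚ ℚ⟮ζ + ζ⁻¹⟯ K
  rw [← IsGalois.card_fixingSubgroup_eq_finrank, card_fixingSubgroup_adjoin_add_inv hζ hn,
    adjoin.finrank (Algebra.IsIntegral.isIntegral _),
    IsCyclotomicExtension.finrank K (Polynomial.cyclotomic.irreducible_rat (NeZero.pos n))] at hmul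
  omega

theorem minpoly_add_inv_eq_of_monic (hζ : IsPrimitiveRoot ζ n) (hn : 2 < n)
    {q : Polynomial ℚ} (hq : q.Monic) (hdeg : q.natDegree = n.totient / 2)
    (hroot : Polynomial.aeval (ζ + ζ⁻¹) q = 0) : minpoly ℚ (ζ + ζ⁻¹) = q :=
  (Polynomial.eq_of_monic_of_dvd_of_natDegree_le (minpoly.monic (Algebra.IsIntegral.isIntegral _))
    hq (minpoly.dvd ℚ _ hroot) (hdeg.trans (natDegree_minpoly_add_inv hζ hn).symm).le).symm

end Cyclotomic

section RootsOfUnity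

variable {K : Type*} [Field K] {ζ : K}

theorem cubic_of_isPrimitiveRoot_seven (hζ : IsPrimitiveRoot ζ 7) :
    (ζ + ζ⁻¹) ^ 3 + (ζ + ζ⁻¹) ^ 2 - 2 * (ζ + ζ⁻¹) - 1 = 0 := by
  have hcyc : ζ ^ 6 + ζ ^ 5 + ζ ^ 4 + ζ ^ 3 + ζ ^ 2 + ζ + 1 = 0 :=
    mul_left_cancel₀ (sub_ne_zero.2 (hζ.ne_one (by norm_num)))
      (by linear_combination hζ.pow_eq_one)
  have hζ0 : ζ ≠ 0 := hζ.ne_zero (by norm_num)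
  field_simp
  linear_combination hcyc

theorem cubic_of_isPrimitiveRoot_eighteen (hζ : IsPrimitiveRoot ζ 18) :
    (ζ + ζ⁻¹) ^ 3 - 3 * (ζ + ζ⁻¹) - 1 = 0 := by
  have hpow : ζ ^ 9 = -1 := pow_half_eq_neg_one (by norm_num) hζ
  have hne : ζ ^ 3 ≠ -1 := fun h =>
    hζ.pow_ne_one_of_pos_of_lt (l := 6) (by norm_num) (by norm_num)
      (by linear_combination (ζ ^ 3 - 1) * h)
  have hcyc : ζ ^ 6 - ζ ^ 3 + 1 = 0 :=
    mul_left_cancel₀ (sub_ne_zero.2 hne) (by linear_combination hpow)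
  have hζ0 : ζ ≠ 0 := hζ.ne_zero (by norm_num)
  field_simp
  linear_combination hcyc

theorem quartic_of_isPrimitiveRoot_fifteen (hζ : IsPrimitiveRoot ζ 15) :
    (ζ + ζ⁻¹) ^ 4 - (ζ + ζ⁻¹) ^ 3 - 4 * (ζ + ζ⁻¹) ^ 2 + 4 * (ζ + ζ⁻¹) + 1 = 0 := by
  have hthree : ζ ^ 10 + ζ ^ 5 + 1 = 0 :=
    mul_left_cancel₀
      (sub_ne_zero.2 (hζ.pow_ne_one_of_pos_of_lt (l := 5) (by norm_num) (by norm_num)))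
      (by linear_combination hζ.pow_eq_one)
  have hne : ζ ^ 2 + ζ + 1 ≠ 0 := fun h =>
    hζ.pow_ne_one_of_pos_of_lt (l := 3) (by norm_num) (by norm_num)
      (by linear_combination (ζ - 1) * h)
  have hcyc : ζ ^ 8 - ζ ^ 7 + ζ ^ 5 - ζ ^ 4 + ζ ^ 3 - ζ + 1 = 0 :=
    mul_left_cancel₀ hne (by linear_combination hthree)
  have hζ0 : ζ ≠ 0 := hζ.ne_zero (by norm_num)
  field_simp
  linear_combination hcyc

theorem quartic_of_isPrimitiveRoot_sixteen (hζ : IsPrimitiveRoot ζ 16) :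
    (ζ + ζ⁻¹) ^ 4 - 4 * (ζ + ζ⁻¹) ^ 2 + 2 = 0 := by
  have hpow : ζ ^ 8 = -1 := pow_half_eq_neg_one (by norm_num) hζ
  have hζ0 : ζ ≠ 0 := hζ.ne_zero (by norm_num)
  field_simp
  linear_combination hpow

theorem quartic_of_isPrimitiveRoot_twenty (hζ : IsPrimitiveRoot ζ 20) :
    (ζ + ζ⁻¹) ^ 4 - 5 * (ζ + ζ⁻¹) ^ 2 + 5 = 0 := by
  have hpow : ζ ^ 10 = -1 := pow_half_eq_neg_one (by norm_num) hζ
  have hne : ζ ^ 2 ≠ -1 := fun h =>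
    hζ.pow_ne_one_of_pos_of_lt (l := 4) (by norm_num) (by norm_num)
      (by linear_combination (ζ ^ 2 - 1) * h)
  have hcyc : ζ ^ 8 - ζ ^ 6 + ζ ^ 4 - ζ ^ 2 + 1 = 0 :=
    mul_left_cancel₀ (sub_ne_zero.2 hne) (by linear_combination hpow)
  have hζ0 : ζ ≠ 0 := hζ.ne_zero (by norm_num)
  field_simp
  linear_combination hcyc

theorem quartic_of_isPrimitiveRoot_twentyFour (hζ : IsPrimitiveRoot ζ 24) :
    (ζ + ζ⁻¹) ^ 4 - 4 * (ζ + ζ⁻¹) ^ 2 + 1 = 0 := by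
  have hpow : ζ ^ 12 = -1 := pow_half_eq_neg_one (by norm_num) hζ
  have hne : ζ ^ 4 ≠ -1 := fun h =>
    hζ.pow_ne_one_of_pos_of_lt (l := 8) (by norm_num) (by norm_num)
      (by linear_combination (ζ ^ 4 - 1) * h)
  have hcyc : ζ ^ 8 - ζ ^ 4 + 1 = 0 :=
    mul_left_cancel₀ (sub_ne_zero.2 hne) (by linear_combination hpow)
  have hζ0 : ζ ≠ 0 := hζ.ne_zero (by norm_num)
  field_simp
  linear_combination hcyc

end RootsOfUnity

section Involution

variable {K : Type*} [Field K] [CharZero K] [IsAbelianGalois ℚ K] {α : K}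
  {σ τ : K ≃ₐ[ℚ] K} {c : ℚ}

theorem apply_sq_mul_apply_apply_sq (hσ : α * σ α = c) : τ α ^ 2 * σ (τ α ^ 2) = c ^ 2 := by
  rw [map_pow, algEquiv_apply_comm, ← mul_pow, ← map_mul, hσ, map_ratCast]

theorem quartic_eq_zero_of_apply_sq_eq_four_sub (hσ : α * σ α = c) (hτ : τ α ^ 2 = 4 - α ^ 2) :
    α ^ 4 - 4 * α ^ 2 + c ^ 2 = 0 := by
  have hprod := apply_sq_mul_apply_apply_sq (τ := τ) hσ
  rw [hτ, map_sub, map_pow, map_ofNat] at hprod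
  linear_combination -(1 / 4) * α ^ 2 * hprod - (1 / 4) * (4 - α ^ 2) * (α * σ α + c) * hσ

theorem quartic_eq_zero_of_apply_sq_eq_four_mul_sub (hc : c ≠ 0) (hσ : α * σ α = c)
    (hτ : τ α ^ 2 = 4 * α ^ 2 - α ^ 4) :
    4 * α ^ 4 - (15 + c ^ 2) * α ^ 2 + 4 * c ^ 2 = 0 := by
  have hprod := apply_sq_mul_apply_apply_sq (τ := τ) hσ
  rw [hτ, map_sub, map_mul, map_pow, map_pow, map_ofNat, ← hσ] at hprod
  have hc' : (c : K) ≠ 0 := mod_cast hc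
  have hone : (4 - α ^ 2) * (4 - σ α ^ 2) = 1 :=
    mul_left_cancel₀ (pow_ne_zero 2 (hσ ▸ hc')) (by linear_combination hprod)
  linear_combination -α ^ 2 * hone - (4 - α ^ 2) * (α * σ α + c) * hσ

end Involution

theorem sq_ne_natCast_of_prime {p : ℕ} (hp : p.Prime) (c : ℚ) : c ^ 2 ≠ p := fun h =>
  hp.prime.not_isSquare (Rat.isSquare_natCast_iff.1 ⟨c, by rw [← h, sq]⟩)

open Polynomial in
theorem natDegree_minpoly_le_four_of_biquadratic {K : Type*} [Field K] [CharZero K] {α : K}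
    {a b c : ℚ} (ha : a ≠ 0) (h : (a : K) * α ^ 4 + b * α ^ 2 + c = 0) :
    (minpoly ℚ α).natDegree ≤ 4 := by
  have hdeg : (C a * X ^ 4 + C b * X ^ 2 + C c).natDegree = 4 := by compute_degree!
  have hne : C a * X ^ 4 + C b * X ^ 2 + C c ≠ 0 := ne_zero_of_natDegree_gt (hdeg ▸ four_pos)
  exact hdeg ▸ natDegree_le_of_dvd (minpoly.dvd ℚ α (by simpa using h)) hne

section FourDvd

variable {m : ℕ} [NeZero (4 * m)] {K : Type*} [Field K] [NumberField K]
  [IsCyclotomicExtension {4 * m} ℚ K] {ζ : K}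

theorem exists_algEquiv_add_inv_eq_neg (hζ : IsPrimitiveRoot ζ (4 * m)) :
    ∃ τ : K ≃ₐ[ℚ] K, τ (ζ + ζ⁻¹) = -(ζ + ζ⁻¹) := by
  have hcop : (2 * m + 1).Coprime (4 * m) := by
    rw [show 4 * m = 2 * (2 * m) by ring]
    exact .mul_right (by simp) (by simp)
  obtain ⟨τ, hτ⟩ := exists_algEquiv_apply_eq_pow hζ hcop
  have hpow : ζ ^ (2 * m) = -1 :=
    pow_half_eq_neg_one (by simpa using NeZero.ne (4 * m)) (by convert hζ using 1; ring)
  refine ⟨τ, ?_⟩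
  rw [map_add, map_inv₀, hτ, pow_succ, hpow, neg_one_mul, inv_neg, neg_add]

theorem sq_mul_add_inv_of_sq_eq_neg_one {K : Type*} [Field K] {i x : K} (hi : i ^ 2 = -1)
    (hx : x ≠ 0) : (i * x + (i * x)⁻¹) ^ 2 = 4 - (x + x⁻¹) ^ 2 := by
  have hinv : i⁻¹ = -i := inv_eq_of_mul_eq_one_right (by linear_combination -hi)
  rw [mul_inv, hinv]
  field_simp
  linear_combination (x ^ 2 - 1) ^ 2 * hi

theorem exists_algEquiv_sq_add_inv_of_even (hζ : IsPrimitiveRoot ζ (4 * m)) (hm : Even m) :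
    ∃ τ : K ≃ₐ[ℚ] K, τ (ζ + ζ⁻¹) ^ 2 = 4 - (ζ + ζ⁻¹) ^ 2 := by
  have hcop : (m + 1).Coprime (4 * m) :=
    .mul_right (.pow_right 2 (Nat.coprime_two_right.2 hm.add_one)) (by simp)
  obtain ⟨τ, hτ⟩ := exists_algEquiv_apply_eq_pow hζ hcop
  have hi : (ζ ^ m) ^ 2 = -1 := by
    rw [← pow_mul]
    exact pow_half_eq_neg_one (by simpa using NeZero.ne (4 * m)) (by convert hζ using 1; ring)
  refine ⟨τ, ?_⟩
  rw [map_add, map_inv₀, hτ, pow_succ ζ]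
  exact sq_mul_add_inv_of_sq_eq_neg_one hi (hζ.ne_zero (NeZero.ne _))

theorem exists_algEquiv_sq_add_inv_of_odd (hζ : IsPrimitiveRoot ζ (4 * m)) (hm : Odd m) :
    ∃ τ : K ≃ₐ[ℚ] K, τ (ζ + ζ⁻¹) ^ 2 = 4 * (ζ + ζ⁻¹) ^ 2 - (ζ + ζ⁻¹) ^ 4 := by
  have hcop : (m + 2).Coprime (4 * m) :=
    .mul_right (.pow_right 2 (Nat.coprime_two_right.2 (hm.add_even even_two)))
      (by simpa using hm)
  obtain ⟨τ, hτ⟩ := exists_algEquiv_apply_eq_pow hζ hcop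
  have hi : (ζ ^ m) ^ 2 = -1 := by
    rw [← pow_mul]
    exact pow_half_eq_neg_one (by simpa using NeZero.ne (4 * m)) (by convert hζ using 1; ring)
  have hζ0 : ζ ≠ 0 := hζ.ne_zero (NeZero.ne _)
  refine ⟨τ, ?_⟩
  rw [map_add, map_inv₀, hτ, pow_add, sq_mul_add_inv_of_sq_eq_neg_one hi (pow_ne_zero 2 hζ0)]
  field_simp
  ring

theorem mul_algEquiv_apply_ne_of_even (hζ : IsPrimitiveRoot ζ (4 * m)) (hm : Even m)
    (h24 : 4 * m ≠ 24) (hd : 4 ≤ (4 * m).totient / 2) (σ : K ≃ₐ[ℚ] K) (c : ℚ) :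
    (ζ + ζ⁻¹) * σ (ζ + ζ⁻¹) ≠ c := fun hσ => by
  have := IsCyclotomicExtension.isAbelianGalois {4 * m} ℚ K
  have hm0 := NeZero.pos (4 * m)
  obtain ⟨τ, hτ⟩ := exists_algEquiv_sq_add_inv_of_even hζ hm
  have hquartic := quartic_eq_zero_of_apply_sq_eq_four_sub hσ hτ
  have hle := natDegree_minpoly_le_four_of_biquadratic (α := ζ + ζ⁻¹) (a := 1) (b := -4)
    (c := c ^ 2) one_ne_zero (by push_cast; linear_combination hquartic)
  rw [natDegree_minpoly_add_inv hζ (by omega)] at hle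
  obtain rfl : m = 4 := by
    have := eq_of_four_dvd_of_totient_div_two_eq_four (dvd_mul_right 4 m) (by omega)
    obtain ⟨k, rfl⟩ := hm
    omega
  refine sq_ne_natCast_of_prime Nat.prime_two c ?_
  exact_mod_cast (by linear_combination hquartic - quartic_of_isPrimitiveRoot_sixteen hζ :
    (c : K) ^ 2 = 2)

theorem mul_algEquiv_apply_ne_of_odd (hζ : IsPrimitiveRoot ζ (4 * m)) (hm : Odd m)
    (hd : 4 ≤ (4 * m).totient / 2) (σ : K ≃ₐ[ℚ] K) (c : ℚ) :
    (ζ + ζ⁻¹) * σ (ζ + ζ⁻¹) ≠ c := fun hσ => by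
  have := IsCyclotomicExtension.isAbelianGalois {4 * m} ℚ K
  have hm0 := NeZero.pos (4 * m)
  have hdeg := natDegree_minpoly_add_inv hζ (by omega)
  have hc : c ≠ 0 := by
    rintro rfl
    rw [Rat.cast_zero, mul_eq_zero, EmbeddingLike.map_eq_zero_iff, or_self] at hσ
    rw [hσ, minpoly.zero, Polynomial.natDegree_X] at hdeg
    omega
  obtain ⟨τ, hτ⟩ := exists_algEquiv_sq_add_inv_of_odd hζ hm
  have hquartic := quartic_eq_zero_of_apply_sq_eq_four_mul_sub hc hσ hτ
  have hle := natDegree_minpoly_le_four_of_biquadratic (α := ζ + ζ⁻¹) (a := 4)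
    (b := -(15 + c ^ 2)) (c := 4 * c ^ 2) four_ne_zero (by push_cast; linear_combination hquartic)
  obtain rfl : m = 5 := by
    have := eq_of_four_dvd_of_totient_div_two_eq_four (dvd_mul_right 4 m) (by omega)
    obtain ⟨k, rfl⟩ := hm
    omega
  have hcoeff := coeffs_eq_zero_of_quadratic_eq_zero (α := ζ + ζ⁻¹) (a := 5 - c ^ 2) (b := 0)
    (c := 4 * c ^ 2 - 20) (by omega) (by
      push_cast
      linear_combination hquartic - 4 * quartic_of_isPrimitiveRoot_twenty hζ)
  exact sq_ne_natCast_of_prime Nat.prime_five c (by push_cast; linear_combination -hcoeff.1)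

end FourDvd

section SignChange

theorem matrixConj_signFlip (a b c d : ℚ) :
    matrixConj signFlip !![a, b; c, d] = !![a, -b; -c, d] := by
  change !![-1, 0; 0, 1] * !![a, b; c, d] * !![-1, 0; 0, 1] = _
  simp

variable {m n : ℕ} [NeZero m] [NeZero n] {ζ : ℂ}

theorem psiForm_eq_or_eq_neg_formSubst_signFlip (hζ : IsPrimitiveRoot ζ n)
    (hζ' : IsPrimitiveRoot (-ζ) m) :
    psiForm m = formSubst (psiForm n) signFlip ∨ psiForm m = -formSubst (psiForm n) signFlip := by
  rw [psiForm_eq_minpolyForm hζ', inv_neg, ← neg_add, minpolyForm_neg, ← psiForm_eq_minpolyForm hζ]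
  rcases neg_one_pow_eq_or ℚ (minpoly ℚ (ζ + ζ⁻¹)).natDegree with h | h <;> simp [h]

theorem formAut_psiForm_of_neg (hζ : IsPrimitiveRoot ζ n) (hζ' : IsPrimitiveRoot (-ζ) m) :
    formAut (psiForm m) = matrixConj signFlip '' formAut (psiForm n) := by
  rcases psiForm_eq_or_eq_neg_formSubst_signFlip hζ hζ' with h | h <;> rw [h]
  · exact formAut_formSubst _ signFlip
  · rw [formAut_neg]
    exact formAut_formSubst _ signFlip

theorem formAutAbs_psiForm_of_neg (hζ : IsPrimitiveRoot ζ n) (hζ' : IsPrimitiveRoot (-ζ) m) :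
    formAutAbs (psiForm m) = matrixConj signFlip '' formAutAbs (psiForm n) := by
  rcases psiForm_eq_or_eq_neg_formSubst_signFlip hζ hζ' with h | h <;> rw [h]
  · exact formAutAbs_formSubst _ signFlip
  · rw [formAutAbs_neg]
    exact formAutAbs_formSubst _ signFlip

theorem exists_isPrimitiveRoot_neg (hn : Odd n) :
    ∃ ζ : ℂ, IsPrimitiveRoot ζ n ∧ IsPrimitiveRoot (-ζ) (2 * n) := by
  have hζ := Complex.isPrimitiveRoot_exp n (NeZero.ne n)
  exact ⟨_, hζ, isPrimitiveRoot_neg_of_odd hn hζ⟩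

end SignChange

section Generic

-- The library instance is for the `ℚ`-algebra structure of a splitting field, not for the one that
-- every field of characteristic zero carries; the two are not syntactically equal.
instance isCyclotomicExtension_cyclotomicField_rat (n : ℕ) [NeZero n] :
    IsCyclotomicExtension {n} ℚ (CyclotomicField n ℚ) :=
  CyclotomicField.isCyclotomicExtension n ℚ

variable {n : ℕ} [NeZero n]

theorem natDegree_psiPoly (hn : 2 < n) : (psiPoly n).natDegree = n.totient / 2 := by
  have hζ := IsCyclotomicExtension.zeta_spec n ℚ (CyclotomicField n ℚ)
  rw [psiPoly_eq_minpoly_add_inv hζ, natDegree_minpoly_add_inv hζ hn]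

theorem formAutAbs_psiForm_of_odd (hn : Odd n) (hd : 5 ≤ n.totient / 2) :
    formAutAbs (psiForm n) = {1, -1} := by
  have := IsCyclotomicExtension.isAbelianGalois {n} ℚ (CyclotomicField n ℚ)
  have hζ := IsCyclotomicExtension.zeta_spec n ℚ (CyclotomicField n ℚ)
  have hle := n.totient_le
  obtain ⟨τ, hτ⟩ := exists_algEquiv_add_inv_eq_sq_sub_two hζ hn
  rw [psiForm_eq_minpolyForm hζ]
  exact formAutAbs_minpolyForm_of_sq_sub_two
    (by rwa [natDegree_minpoly_add_inv hζ (by omega)]) hτ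

theorem formAutAbs_psiForm_of_not_four_dvd (h4 : ¬ 4 ∣ n) (hd : 5 ≤ n.totient / 2) :
    formAutAbs (psiForm n) = {1, -1} := by
  rcases n.even_or_odd' with ⟨m, rfl | rfl⟩
  · have hm : Odd m := by
      by_contra h
      obtain ⟨k, rfl⟩ := Nat.not_odd_iff_even.1 h
      omega
    have : NeZero m := ⟨hm.pos.ne'⟩
    obtain ⟨ζ, hζ, hζ'⟩ := exists_isPrimitiveRoot_neg hm
    rw [Nat.totient_two_mul_of_odd hm] at hd
    rw [formAutAbs_psiForm_of_neg hζ hζ', formAutAbs_psiForm_of_odd hm hd, Set.image_pair]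
    simp [matrixConj]
  · exact formAutAbs_psiForm_of_odd (odd_two_mul_add_one m) hd

theorem formAut_psiForm_of_odd_totient_div_two (hd : Odd (n.totient / 2))
    (hd' : 5 ≤ n.totient / 2) : formAut (psiForm n) = {1} ∧ formAutAbs (psiForm n) = {1, -1} := by
  have hle := n.totient_le
  have hdeg := natDegree_psiPoly (n := n) (by omega)
  have h4 : ¬ 4 ∣ n := fun h4 =>
    Nat.not_even_iff_odd.2 hd (even_totient_div_two_of_four_dvd h4 (by omega))
  have habs := formAutAbs_psiForm_of_not_four_dvd h4 hd'
  exact ⟨formAut_eq_of_formAutAbs_eq_of_odd (isHomogeneous_minpolyForm _) (hdeg ▸ hd)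
    (minpolyForm_ne_zero (hdeg.ge.trans' (by omega))) habs, habs⟩

theorem formAut_psiForm_of_even_totient_div_two (hd : Even (n.totient / 2))
    (hd' : 5 ≤ n.totient / 2) (h4 : ¬ 4 ∣ n) :
    formAut (psiForm n) = {1, -1} ∧ formAutAbs (psiForm n) = {1, -1} := by
  have hle := n.totient_le
  have hdeg := natDegree_psiPoly (n := n) (by omega)
  have habs := formAutAbs_psiForm_of_not_four_dvd h4 hd'
  exact ⟨formAut_eq_of_formAutAbs_eq_of_even (isHomogeneous_minpolyForm _) (hdeg ▸ hd) habs, habs⟩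

theorem formAut_psiForm_of_four_dvd (h4 : 4 ∣ n) (h24 : n ≠ 24) (hd : 3 ≤ n.totient / 2) :
    formAut (psiForm n) = matrixGroup {!![-1, 0; 0, 1], !![1, 0; 0, -1]} ∧
      formAutAbs (psiForm n) = matrixGroup {!![-1, 0; 0, 1], !![1, 0; 0, -1]} := by
  have := IsCyclotomicExtension.isAbelianGalois {n} ℚ (CyclotomicField n ℚ)
  have hζ := IsCyclotomicExtension.zeta_spec n ℚ (CyclotomicField n ℚ)
  have hle := n.totient_le
  have heven := even_totient_div_two_of_four_dvd h4 (by omega)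
  have hd4 : 4 ≤ n.totient / 2 := hd.lt_of_ne fun h => by simp [← h, parity_simps] at heven
  have hdeg := natDegree_minpoly_add_inv hζ (by omega)
  obtain ⟨m, rfl⟩ := h4
  obtain ⟨τ, hτ⟩ := exists_algEquiv_add_inv_eq_neg hζ
  rw [psiForm_eq_minpolyForm hζ]
  refine formAut_minpolyForm_of_neg (hdeg ▸ hd) (hdeg ▸ heven) hτ ?_
  rcases m.even_or_odd with hm | hm
  · exact mul_algEquiv_apply_ne_of_even hζ hm h24 hd4
  · exact mul_algEquiv_apply_ne_of_odd hζ hm hd4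

end Generic

section Exceptional

open Polynomial

theorem formAut_psiForm_of_simplest_cubic {n : ℕ} [NeZero n] (hn : n.totient / 2 = 3) {a : ℚ}
    (h : ∀ ζ : CyclotomicField n ℚ, IsPrimitiveRoot ζ n →
      aeval (ζ + ζ⁻¹) (X ^ 3 + C a * X ^ 2 + C (a - 3) * X - 1 : ℚ[X]) = 0) :
    formAut (psiForm n) = matrixGroup {!![-1, -1; 1, 0]} ∧
      formAutAbs (psiForm n) = matrixGroup {!![-1, -1; 1, 0], !![-1, 0; 0, -1]} := by
  have := IsCyclotomicExtension.isAbelianGalois {n} ℚ (CyclotomicField n ℚ)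
  have hζ := IsCyclotomicExtension.zeta_spec n ℚ (CyclotomicField n ℚ)
  have hle := n.totient_le
  rw [psiForm_eq_minpolyForm hζ]
  exact formAut_minpolyForm_of_simplest_cubic (minpoly_add_inv_eq_of_monic hζ (by omega)
    (by monicity!) (by rw [hn]; compute_degree!) (h _ hζ))

theorem formAut_psiForm_seven :
    formAut (psiForm 7) = matrixGroup {!![-1, -1; 1, 0]} ∧
      formAutAbs (psiForm 7) = matrixGroup {!![-1, -1; 1, 0], !![-1, 0; 0, -1]} :=
  formAut_psiForm_of_simplest_cubic (by decide +kernel) (a := 1) fun ζ hζ => by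
    simpa using (by linear_combination cubic_of_isPrimitiveRoot_seven hζ)

theorem formAut_psiForm_eighteen :
    formAut (psiForm 18) = matrixGroup {!![-1, -1; 1, 0]} ∧
      formAutAbs (psiForm 18) = matrixGroup {!![-1, -1; 1, 0], !![-1, 0; 0, -1]} :=
  formAut_psiForm_of_simplest_cubic (by decide +kernel) (a := 0) fun ζ hζ => by
    simpa using (by linear_combination cubic_of_isPrimitiveRoot_eighteen hζ)

theorem formAut_psiForm_fourteen :
    formAut (psiForm 14) = matrixGroup {!![-1, 1; -1, 0]} ∧
      formAutAbs (psiForm 14) = matrixGroup {!![-1, 1; -1, 0], !![-1, 0; 0, -1]} := by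
  obtain ⟨ζ, hζ, hζ'⟩ := exists_isPrimitiveRoot_neg (n := 7) (by decide)
  rw [formAut_psiForm_of_neg hζ hζ', formAutAbs_psiForm_of_neg hζ hζ',
    formAut_psiForm_seven.1, formAut_psiForm_seven.2]
  simp [image_matrixConj_matrixGroup, Set.image_pair, matrixConj_signFlip]

theorem formAut_psiForm_nine :
    formAut (psiForm 9) = matrixGroup {!![-1, 1; -1, 0]} ∧
      formAutAbs (psiForm 9) = matrixGroup {!![-1, 1; -1, 0], !![-1, 0; 0, -1]} := by
  obtain ⟨ζ, hζ, hζ'⟩ := exists_isPrimitiveRoot_neg (n := 9) (by decide)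
  rw [← neg_neg ζ] at hζ
  rw [formAut_psiForm_of_neg hζ' hζ, formAutAbs_psiForm_of_neg hζ' hζ,
    formAut_psiForm_eighteen.1, formAut_psiForm_eighteen.2]
  simp [image_matrixConj_matrixGroup, Set.image_pair, matrixConj_signFlip]

theorem formAut_psiForm_fifteen :
    formAut (psiForm 15) = matrixGroup {!![-1, 2; -1, 1]} ∧
      formAutAbs (psiForm 15) = matrixGroup {!![-1, 2; -1, 1]} := by
  have := IsCyclotomicExtension.isAbelianGalois {15} ℚ (CyclotomicField 15 ℚ)
  have hζ := IsCyclotomicExtension.zeta_spec 15 ℚ (CyclotomicField 15 ℚ)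
  rw [psiForm_eq_minpolyForm hζ]
  exact formAut_minpolyForm_of_quartic_fifteen (minpoly_add_inv_eq_of_monic hζ (by norm_num)
    (by monicity!) (by rw [show Nat.totient 15 / 2 = 4 by decide +kernel]; compute_degree!)
    (by simpa [map_ofNat] using quartic_of_isPrimitiveRoot_fifteen hζ))

theorem formAut_psiForm_twentyFour :
    formAut (psiForm 24) = groupD4 ∧ formAutAbs (psiForm 24) = groupD4 := by
  have := IsCyclotomicExtension.isAbelianGalois {24} ℚ (CyclotomicField 24 ℚ)
  have hζ := IsCyclotomicExtension.zeta_spec 24 ℚ (CyclotomicField 24 ℚ)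
  rw [psiForm_eq_minpolyForm hζ]
  exact formAut_minpolyForm_of_palindromic_quartic (b := -4)
    (minpoly_add_inv_eq_of_monic hζ (by norm_num) (by monicity!)
      (by rw [show Nat.totient 24 / 2 = 4 by decide +kernel]; compute_degree!)
      (by simpa using (by linear_combination quartic_of_isPrimitiveRoot_twentyFour hζ)))

theorem formAut_psiForm_thirty :
    formAut (psiForm 30) = matrixGroup {!![1, 2; -1, -1]} ∧
      formAutAbs (psiForm 30) = matrixGroup {!![1, 2; -1, -1]} := by
  obtain ⟨ζ, hζ, hζ'⟩ := exists_isPrimitiveRoot_neg (n := 15) (by decide)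
  have hgroup : matrixConj signFlip '' matrixGroup {!![-1, 2; -1, 1]} =
      matrixGroup {!![1, 2; -1, -1]} := by
    have hconj : matrixConj signFlip !![-1, 2; -1, 1] = -!![1, 2; -1, -1] := by
      simp [matrixConj_signFlip]
    rw [image_matrixConj_matrixGroup, Set.image_singleton, hconj,
      matrixGroup_neg_of_sq_eq_neg_one (by decide +kernel)]
  rw [formAut_psiForm_of_neg hζ hζ', formAutAbs_psiForm_of_neg hζ hζ',
    formAut_psiForm_fifteen.1, formAut_psiForm_fifteen.2]
  exact ⟨hgroup, hgroup⟩

end Exceptional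

theorem theorem1p1 (n d : ℕ) (hn : 0 < n)
    (hn' : n ∉ ({1, 2, 3, 4, 5, 6, 8, 10, 12} : Set ℕ)) (hd : d = Nat.totient n / 2) :
    ((psiPoly n).natDegree = d ∧ 3 ≤ d) ∧
    -- `d ≥ 5` odd
    (5 ≤ d → Odd d →
      (formAut (psiForm n) = {1} ∧ GLConjugate (formAut (psiForm n)) groupC1) ∧
      (formAutAbs (psiForm n) = {1, -1} ∧ GLConjugate (formAutAbs (psiForm n)) groupC2)) ∧
    -- `d ≥ 6` even, `4 ∤ n`
    (6 ≤ d → Even d → ¬ 4 ∣ n →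
      formAut (psiForm n) = formAutAbs (psiForm n) ∧
      formAutAbs (psiForm n) = {1, -1} ∧ GLConjugate (formAutAbs (psiForm n)) groupC2) ∧
    -- `4 ∣ n`, `n ≠ 24`
    (4 ∣ n → n ≠ 24 →
      formAut (psiForm n) = formAutAbs (psiForm n) ∧
      formAutAbs (psiForm n) = matrixGroup {!![-1, 0; 0, 1], !![1, 0; 0, -1]} ∧
      GLConjugate (formAutAbs (psiForm n)) groupD2) ∧
    -- the exceptional values of `n`
    (n = 7 ∨ n = 18 →
      (formAut (psiForm n) = matrixGroup {!![-1, -1; 1, 0]} ∧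
        GLConjugate (formAut (psiForm n)) groupC3) ∧
      (formAutAbs (psiForm n) = matrixGroup {!![-1, -1; 1, 0], !![-1, 0; 0, -1]} ∧
        GLConjugate (formAutAbs (psiForm n)) groupC6)) ∧
    (n = 9 ∨ n = 14 →
      (formAut (psiForm n) = matrixGroup {!![-1, 1; -1, 0]} ∧
        GLConjugate (formAut (psiForm n)) groupC3) ∧
      (formAutAbs (psiForm n) = matrixGroup {!![-1, 1; -1, 0], !![-1, 0; 0, -1]} ∧
        GLConjugate (formAutAbs (psiForm n)) groupC6)) ∧
    (n = 15 →
      (formAut (psiForm n) = matrixGroup {!![-1, 2; -1, 1]} ∧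
        GLConjugate (formAut (psiForm n)) groupC4) ∧
      (formAutAbs (psiForm n) = matrixGroup {!![-1, 2; -1, 1]} ∧
        GLConjugate (formAutAbs (psiForm n)) groupC4)) ∧
    (n = 24 →
      (formAut (psiForm n) = matrixGroup {!![0, 1; 1, 0], !![0, 1; -1, 0]} ∧
        GLConjugate (formAut (psiForm n)) groupD4) ∧
      (formAutAbs (psiForm n) = matrixGroup {!![0, 1; 1, 0], !![0, 1; -1, 0]} ∧
        GLConjugate (formAutAbs (psiForm n)) groupD4)) ∧
    (n = 30 →
      (formAut (psiForm n) = matrixGroup {!![1, 2; -1, -1]} ∧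
        GLConjugate (formAut (psiForm n)) groupC4) ∧
      (formAutAbs (psiForm n) = matrixGroup {!![1, 2; -1, -1]} ∧
        GLConjugate (formAutAbs (psiForm n)) groupC4)) := by
  subst hd
  have : NeZero n := ⟨hn.ne'⟩
  have hd3 := three_le_totient_div_two hn hn'
  have hle := n.totient_le
  refine ⟨⟨natDegree_psiPoly (by omega), hd3⟩, fun hd5 hodd => ?_, fun hd6 heven h4 => ?_,
    fun h4 h24 => ?_, ?_, ?_, ?_, ?_, ?_⟩
  · simp [formAut_psiForm_of_odd_totient_div_two hodd hd5, groupC1_eq, groupC2_eq, GLConjugate.refl]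
  · have hd5 : 5 ≤ n.totient / 2 := by omega
    simp [formAut_psiForm_of_even_totient_div_two heven hd5 h4, groupC2_eq, GLConjugate.refl]
  · simpa [formAut_psiForm_of_four_dvd h4 h24 hd3] using glConjugate_groupD2
  · have hconj := And.intro glConjugate_groupC3 glConjugate_groupC6
    rintro (rfl | rfl)
    exacts [by simpa [formAut_psiForm_seven], by simpa [formAut_psiForm_eighteen]]
  · have hconj := And.intro glConjugate_groupC3' glConjugate_groupC6'
    rintro (rfl | rfl)
    exacts [by simpa [formAut_psiForm_nine], by simpa [formAut_psiForm_fourteen]]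
  · rintro rfl
    simpa [formAut_psiForm_fifteen] using glConjugate_groupC4
  · rintro rfl
    simpa [formAut_psiForm_twentyFour, groupD4] using GLConjugate.refl groupD4
  · rintro rfl
    simpa [formAut_psiForm_thirty] using glConjugate_groupC4'
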